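/- All compact and locally compact spaces are assumed Hausdorff. A space with involution $(X,\tau)$ is a topological space $X$ with a continuous map $\tau\colon X\to X$, $\tau^2=\mathrm{id}$; a map $(X_1,\tau_1)\to(X_2,\tau_2)$ is a continuous map $f$ with $f\tau_1=\tau_2 f$. \emph{Definitions.} For a unital real $C^*$-algebra $A$, let $\mathcal P_\infty(A)$ be the abelian semigroup of projections $p=p^2=p^*\in M_n(A)$ ($n\ge 0$), where two projections are identified if they become unitarily equivalent in some $M_N(A)$ after adding zeros, with addition $[p]+[q]=[\mathrm{diag}(p,q)]$. Then $KO_0(A)=\mathrm{Groth}(\mathcal P_\infty(A))$ is its Grothendieck group. For an arbitrary real $C^*$-algebra $A$ with unitization $A^+=A\oplus\mathbb R$ (in the locally compact statement below) $KO_0(A)=\ker\bigl[KO_0(A^+)\to KO_0(\mathbb R)\bigr]$. For compact $X$, a complex vector bundle with involution over $(X,\tau)$ is a locally trivial complex vector bundle $\pi\colon E\to X$ of finite (locally constant) rank with a continuous involution $\sigma$ of $E$ which is conjugate-linear on the fibres and satisfies $\pi\sigma=\tau\pi$. With $\mathrm{Vect}(X,\tau)$ the semigroup of isomorphism classes of such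 bundles under direct sum, $KR^0(X,\tau)=\mathrm{Groth}(\mathrm{Vect}(X,\tau))$, which is contravariant by pullback. For locally compact $X$ with one-point compactification $X^+=X\cup\{\infty\}$ and $\tau^+$ the extension of $\tau$ with $\tau^+(\infty)=\infty$, (in the locally compact statement below) $KR^0(X,\tau)=\ker\bigl[KR^0(X^+,\tau^+)\to KR^0(\{\infty\},\mathrm{id})\bigr]$. \emph{Theorem.} (1) For a compact space with involution $(X,\tau)$ let $A(X,\tau)=\{f\in C(X,\mathbb C): f(\tau x)=\overline{f(x)}\ \forall x\}$. There is an isomorphism of abelian groups $$\Theta=\Theta_{(X,\tau)}\colon KO_0(A(X,\tau))\xrightarrow{\ \cong\ }KR^0(X,\tau)$$ with $\Theta[p]=[E_p]$ for every projection $p\in M_n(A(X,\tau))$, where $E_p=\{(x,v)\in X\times\mathbb C^n: p(x)v=v\}$ carries the involution $(x,v)\mapsto(\tau x,\bar v)$. It is natural: for every map $f\colon(X_1,\tau_1)\to(X_2,\tau_2)$ of compact spaces with involution, $\Theta_{(X_1,\tau_1)}\circ (f^*)_*=f^*\circ\Theta_{(X_2,\tau_2)}$, where $f^*\colon A(X_2,\tau_2)\to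 A(X_1,\tau_1)$, $g\mapsto g\circ f$. (2) For a locally compact space with involution $(X,\tau)$ let $A_0(X,\tau)=\{f\in C_0(X,\mathbb C): f(\tau x)=\overline{f(x)}\ \forall x\}$. There is an isomorphism of abelian groups $$\Theta'=\Theta'_{(X,\tau)}\colon KO_0(A_0(X,\tau))\xrightarrow{\ \cong\ }KR^0(X,\tau),$$ namely the restriction of $\Theta_{(X^+,\tau^+)}$, where $A_0(X,\tau)^+$ is mapped to $A(X^+,\tau^+)$ by sending $(f,r)$ to the function with value $f(x)+r$ at $x\in X$ and $r$ at $\infty$. It is natural for proper maps $f\colon(X_1,\tau_1)\to(X_2,\tau_2)$ of locally compact spaces with involution. -/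

import Mathlib

universe u u₁ u₂ u₃ v w

open scoped Matrix

noncomputable section

namespace KRTheory

/-! ## `KO₀` of a unital real C*-algebra -/

section Projections

/-- A projection `p = p² = p*` in a matrix algebra `M_n(A)`. -/
structure MatProj (A : Type v) [Ring A] [StarRing A] where
  size : ℕ
  mat : Matrix (Fin size) (Fin size) A
  isStarProjection : IsStarProjection mat

/-- The matrix `M ⊕ 0 ∈ M_N(A)`, for `M ∈ M_n(A)` and `n ≤ N`. -/
def pad {A : Type v} [Zero A] {n : ℕ} (N : ℕ) (M : Matrix (Fin n) (Fin n) A) :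
    Matrix (Fin N) (Fin N) A :=
  fun i j => if h : i.1 < n ∧ j.1 < n then M ⟨i.1, h.1⟩ ⟨j.1, h.2⟩ else 0

/-- The relation defining `𝒫_∞(A)`: two projections are equivalent if they become unitarily
equivalent in some `M_N(A)` after adding zeros. -/
def ProjEquiv {A : Type v} [Ring A] [StarRing A] (p q : MatProj A) : Prop :=
  ∃ N : ℕ, p.size ≤ N ∧ q.size ≤ N ∧
    ∃ U ∈ unitary (Matrix (Fin N) (Fin N) A), U * pad N p.mat * star U = pad N q.mat

/-- The block sum `p ⊕ q = diag(p, q)`. -/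
def blockSum {A : Type v} [Zero A] {m n : ℕ} (M : Matrix (Fin m) (Fin m) A)
    (M' : Matrix (Fin n) (Fin n) A) : Matrix (Fin (m + n)) (Fin (m + n)) A :=
  Matrix.reindex finSumFinEquiv finSumFinEquiv (Matrix.fromBlocks M 0 0 M')

theorem blockSum_apply {A : Type v} [Zero A] {m n : ℕ} (M : Matrix (Fin m) (Fin m) A) (M' : Matrix (Fin n) (Fin n) A)
    (i j : Fin m ⊕ Fin n) : blockSum M M' (finSumFinEquiv i) (finSumFinEquiv j) =
      Matrix.fromBlocks M 0 0 M' i j := by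
  rw [blockSum, Matrix.reindex_apply, Matrix.submatrix_apply, Equiv.symm_apply_apply,
    Equiv.symm_apply_apply]

theorem blockSum_map {A : Type v} {B : Type w} [Zero A] [Zero B] {m n : ℕ} (M : Matrix (Fin m) (Fin m) A)
    (M' : Matrix (Fin n) (Fin n) A) (f : A → B) (hf : f 0 = 0) :
    (blockSum M M').map f = blockSum (M.map f) (M'.map f) := by
  simp only [blockSum, Matrix.reindex_apply, ← Matrix.submatrix_map, Matrix.fromBlocks_map,
    Matrix.map_zero _ hf]

variable {A : Type v} [Ring A] [StarRing A]

/-- Auxiliary (for the proofs that `𝒫_∞(A)` is an abelian semigroup): equivalence of matrices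
through a rectangular partial isometry. -/
def PartialIsomEquiv {ι κ : Type*} [Fintype ι] [Fintype κ] (P : Matrix ι ι A)
    (Q : Matrix κ κ A) : Prop :=
  ∃ S : Matrix κ ι A, Sᴴ * S = P ∧ S * Sᴴ = Q

theorem isStarProjection_iff_matrix {ι : Type*} [Fintype ι] (P : Matrix ι ι A) :
    IsStarProjection P ↔ P * P = P ∧ Pᴴ = P :=
  ⟨fun h => ⟨h.isIdempotentElem, h.isSelfAdjoint⟩, fun h => ⟨h.1, h.2⟩⟩

theorem PartialIsomEquiv.refl {ι : Type*} [Fintype ι] {P : Matrix ι ι A}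
    (h : IsStarProjection P) : PartialIsomEquiv P P := by
  obtain ⟨h1, h2⟩ := (isStarProjection_iff_matrix P).1 h
  exact ⟨P, by rw [h2, h1], by rw [h2, h1]⟩

theorem PartialIsomEquiv.symm {ι κ : Type*} [Fintype ι] [Fintype κ] {P : Matrix ι ι A}
    {Q : Matrix κ κ A} : PartialIsomEquiv P Q → PartialIsomEquiv Q P := by
  rintro ⟨S, h1, h2⟩
  exact ⟨Sᴴ, by simpa using h2, by simpa using h1⟩

theorem PartialIsomEquiv.exists_mul {ι κ : Type*} [Fintype ι] [Fintype κ]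
    {P : Matrix ι ι A} {Q : Matrix κ κ A} (hP : P * P = P) (hQ : Q * Q = Q) :
    PartialIsomEquiv P Q →
      ∃ S : Matrix κ ι A, Sᴴ * S = P ∧ S * Sᴴ = Q ∧ S * P = S ∧ Q * S = S := by
  rintro ⟨S, h1, h2⟩
  have e1 : Q * S = S * P := by rw [← h1, ← h2, Matrix.mul_assoc]
  have hPs : Pᴴ = P := by rw [← h1]; simp
  refine ⟨S * P, ?_, ?_, ?_, ?_⟩
  · rw [Matrix.conjTranspose_mul, hPs, Matrix.mul_assoc, ← Matrix.mul_assoc Sᴴ, h1, hP, hP]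
  · rw [Matrix.conjTranspose_mul, hPs, ← Matrix.mul_assoc, Matrix.mul_assoc S, hP, ← e1,
      Matrix.mul_assoc, h2, hQ]
  · rw [Matrix.mul_assoc, hP]
  · rw [← Matrix.mul_assoc, e1, Matrix.mul_assoc, hP]

theorem PartialIsomEquiv.trans {ι κ μ : Type*} [Fintype ι] [Fintype κ] [Fintype μ]
    {P : Matrix ι ι A} {Q : Matrix κ κ A} {R : Matrix μ μ A}
    (hP : P * P = P) (hQ : Q * Q = Q) (hR : R * R = R)
    (h : PartialIsomEquiv P Q) (h' : PartialIsomEquiv Q R) : PartialIsomEquiv P R := by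
  obtain ⟨S, h1, h2, h3, h4⟩ := h.exists_mul hP hQ
  obtain ⟨T, t1, t2, t3, t4⟩ := h'.exists_mul hQ hR
  refine ⟨T * S, ?_, ?_⟩
  · rw [Matrix.conjTranspose_mul, Matrix.mul_assoc, ← Matrix.mul_assoc Tᴴ, t1, h4, h1]
  · rw [Matrix.conjTranspose_mul, Matrix.mul_assoc, ← Matrix.mul_assoc S, h2,
      ← Matrix.mul_assoc, t3, t2]

theorem PartialIsomEquiv.fromBlocks {ι κ ι' κ' : Type*} [Fintype ι] [Fintype κ] [Fintype ι']
    [Fintype κ'] {P : Matrix ι ι A} {Q : Matrix κ κ A} {P' : Matrix ι' ι' A}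
    {Q' : Matrix κ' κ' A} (h : PartialIsomEquiv P Q) (h' : PartialIsomEquiv P' Q') :
    PartialIsomEquiv (Matrix.fromBlocks P 0 0 P') (Matrix.fromBlocks Q 0 0 Q') := by
  obtain ⟨S, h1, h2⟩ := h
  obtain ⟨T, t1, t2⟩ := h'
  exact ⟨Matrix.fromBlocks S 0 0 T,
    by simp [Matrix.fromBlocks_conjTranspose, Matrix.fromBlocks_multiply, h1, t1],
    by simp [Matrix.fromBlocks_conjTranspose, Matrix.fromBlocks_multiply, h2, t2]⟩

theorem PartialIsomEquiv.submatrix {ι κ : Type*} [Fintype ι] [Fintype κ]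
    {P : Matrix ι ι A} (h : IsStarProjection P) (e : κ ≃ ι) :
    PartialIsomEquiv P (P.submatrix e e) := by
  obtain ⟨h1, h2⟩ := (isStarProjection_iff_matrix P).1 h
  refine ⟨P.submatrix e id, ?_, ?_⟩
  · rw [Matrix.conjTranspose_submatrix, h2]
    simp [h1]
  · rw [Matrix.conjTranspose_submatrix, h2]
    ext i j
    exact congrFun (congrFun h1 (e i)) (e j)

/-- Auxiliary: the standard isometry `A^m → A^N` for `m ≤ N`. -/
def incl (A : Type v) [Ring A] (m N : ℕ) : Matrix (Fin N) (Fin m) A :=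
  fun i j => if i.1 = j.1 then 1 else 0

theorem incl_star_mul {m N : ℕ} (h : m ≤ N) : (incl A m N)ᴴ * incl A m N = 1 := by
  ext i j
  rw [Matrix.mul_apply, Finset.sum_eq_single (Fin.castLE h i)]
  · simp only [incl, Matrix.conjTranspose_apply, Fin.val_castLE, if_true, star_one, one_mul,
      Matrix.one_apply, Fin.ext_iff]
  · intro k _ hk
    have : ¬ k.1 = i.1 := fun h' => hk (Fin.ext h')
    simp [incl, this]
  · simp

theorem pad_eq {m N : ℕ} (M : Matrix (Fin m) (Fin m) A) :
    pad N M = incl A m N * M * (incl A m N)ᴴ := by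
  have key : ∀ (i : Fin N) (b : Fin m), (incl A m N * M) i b =
      if hi : i.1 < m then M ⟨i.1, hi⟩ b else 0 := by
    intro i b
    rw [Matrix.mul_apply]
    split_ifs with hi
    · rw [Finset.sum_eq_single ⟨i.1, hi⟩]
      · simp [incl]
      · intro c _ hc
        have : ¬ i.1 = c.1 := fun h' => hc (Fin.ext h'.symm)
        simp [incl, this]
      · simp
    · refine Finset.sum_eq_zero fun c _ => ?_
      have : ¬ i.1 = c.1 := fun h' => hi (h' ▸ c.2)
      simp [incl, this]
  ext i j
  rw [Matrix.mul_apply]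
  by_cases hj : j.1 < m
  · rw [Finset.sum_eq_single ⟨j.1, hj⟩]
    · by_cases hi : i.1 < m <;> simp [key, pad, hi, hj, incl]
    · intro c _ hc
      have : ¬ j.1 = c.1 := fun h' => hc (Fin.ext h'.symm)
      simp [incl, this]
    · simp
  · rw [Finset.sum_eq_zero]
    · simp [pad, hj]
    · intro c _
      have : ¬ j.1 = c.1 := fun h' => hj (h' ▸ c.2)
      simp [incl, this]

theorem PartialIsomEquiv.pad {m N : ℕ} (h : m ≤ N) {M : Matrix (Fin m) (Fin m) A}
    (hM : IsStarProjection M) : PartialIsomEquiv M (pad N M) := by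
  obtain ⟨h1, h2⟩ := (isStarProjection_iff_matrix M).1 hM
  refine ⟨incl A m N * M, ?_, ?_⟩
  · rw [Matrix.conjTranspose_mul, h2, Matrix.mul_assoc, ← Matrix.mul_assoc _ _ M,
      incl_star_mul h, Matrix.one_mul, h1]
  · rw [Matrix.conjTranspose_mul, h2, pad_eq, ← Matrix.mul_assoc, Matrix.mul_assoc _ M M, h1]

theorem isStarProjection_pad {m N : ℕ} (h : m ≤ N) {M : Matrix (Fin m) (Fin m) A}
    (hM : IsStarProjection M) : IsStarProjection (pad N M) := by
  obtain ⟨h1, h2⟩ := (isStarProjection_iff_matrix M).1 hM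
  rw [isStarProjection_iff_matrix, pad_eq]
  constructor
  · calc incl A m N * M * (incl A m N)ᴴ * (incl A m N * M * (incl A m N)ᴴ)
        = incl A m N * (M * (((incl A m N)ᴴ * incl A m N) * M)) * (incl A m N)ᴴ := by
          simp only [Matrix.mul_assoc]
      _ = _ := by rw [incl_star_mul h, Matrix.one_mul, h1]
  · simp [Matrix.conjTranspose_mul, h2, Matrix.mul_assoc]

/-- After stabilization, unitary equivalence and equivalence through partial isometries agree. -/
theorem projEquiv_iff (p q : MatProj A) : ProjEquiv p q ↔ PartialIsomEquiv p.mat q.mat := by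
  obtain ⟨hp, hp'⟩ := (isStarProjection_iff_matrix p.mat).1 p.isStarProjection
  obtain ⟨hq, hq'⟩ := (isStarProjection_iff_matrix q.mat).1 q.isStarProjection
  constructor
  · rintro ⟨N, hpN, hqN, U, hU, h⟩
    have pP := (isStarProjection_iff_matrix _).1 (isStarProjection_pad hpN p.isStarProjection)
    have pQ := (isStarProjection_iff_matrix _).1 (isStarProjection_pad hqN q.isStarProjection)
    have key : PartialIsomEquiv (KRTheory.pad N p.mat) (KRTheory.pad N q.mat) := by
      have hU' : Uᴴ * U = 1 := (Unitary.mem_iff.1 hU).1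
      refine ⟨U * KRTheory.pad N p.mat, ?_, ?_⟩
      · rw [Matrix.conjTranspose_mul, pP.2, Matrix.mul_assoc, ← Matrix.mul_assoc Uᴴ, hU',
          Matrix.one_mul, pP.1]
      · rw [Matrix.conjTranspose_mul, pP.2, ← Matrix.mul_assoc, Matrix.mul_assoc U, pP.1, ← h]
        rfl
    exact (PartialIsomEquiv.pad hpN p.isStarProjection).trans hp pP.1 hq
      (key.trans pP.1 pQ.1 hq (PartialIsomEquiv.pad hqN q.isStarProjection).symm)
  · intro h
    let N := max p.size q.size
    have hpN : p.size ≤ N := le_max_left _ _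
    have hqN : q.size ≤ N := le_max_right _ _
    have pP := (isStarProjection_iff_matrix _).1 (isStarProjection_pad hpN p.isStarProjection)
    have pQ := (isStarProjection_iff_matrix _).1 (isStarProjection_pad hqN q.isStarProjection)
    have h2 : PartialIsomEquiv (KRTheory.pad N p.mat) (KRTheory.pad N q.mat) :=
      (PartialIsomEquiv.pad hpN p.isStarProjection).symm.trans pP.1 hp pQ.1
        (h.trans hp hq pQ.1 (PartialIsomEquiv.pad hqN q.isStarProjection))
    obtain ⟨S, s1, s2, s3, s4⟩ := h2.exists_mul pP.1 pQ.1
    set P := KRTheory.pad N p.mat with hP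
    set Q := KRTheory.pad N q.mat with hQ
    have s3' : P * Sᴴ = Sᴴ := by
      have := congrArg Matrix.conjTranspose s3
      rwa [Matrix.conjTranspose_mul, pP.2] at this
    have s4' : Sᴴ * Q = Sᴴ := by
      have := congrArg Matrix.conjTranspose s4
      rwa [Matrix.conjTranspose_mul, pQ.2] at this
    let V : Matrix (Fin N ⊕ Fin N) (Fin N ⊕ Fin N) A := Matrix.fromBlocks S (1 - Q) (1 - P) Sᴴ
    have padTwo : ∀ {m : ℕ} (hm : m ≤ N) (M : Matrix (Fin m) (Fin m) A),
        KRTheory.pad (N + N) M =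
          Matrix.reindexAlgEquiv ℕ A finSumFinEquiv
            (Matrix.fromBlocks (KRTheory.pad N M) 0 0 (0 : Matrix (Fin N) (Fin N) A)) := by
      intro m hm M
      ext i j
      rw [Matrix.coe_reindexAlgEquiv]
      simp only [Matrix.reindex_apply, Matrix.submatrix_apply]
      obtain ⟨i | i, rfl⟩ := finSumFinEquiv.surjective i <;>
      obtain ⟨j | j, rfl⟩ := finSumFinEquiv.surjective j <;>
      rw [Equiv.symm_apply_apply, Equiv.symm_apply_apply]
      · simp only [KRTheory.pad, Matrix.fromBlocks_apply₁₁, finSumFinEquiv_apply_left,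
          Fin.val_castAdd]
        rfl
      · have : ¬ (j.1 + N < m) := by omega
        simp [KRTheory.pad, this]
      · have : ¬ (i.1 + N < m) := by omega
        simp [KRTheory.pad, this]
      · have : ¬ (i.1 + N < m) := by omega
        simp [KRTheory.pad, this]
    have hstar : ∀ M : Matrix (Fin N ⊕ Fin N) (Fin N ⊕ Fin N) A,
        star (Matrix.reindexAlgEquiv ℕ A finSumFinEquiv M) =
          Matrix.reindexAlgEquiv ℕ A finSumFinEquiv Mᴴ := fun M => rfl
    have hV : Vᴴ = Matrix.fromBlocks Sᴴ (1 - P) (1 - Q) S := by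
      simp [V, Matrix.fromBlocks_conjTranspose, pP.2, pQ.2]
    have hV1 : Vᴴ * V = 1 := by
      rw [hV, ← Matrix.fromBlocks_one]
      simp only [V, Matrix.fromBlocks_multiply]
      congr 1 <;> simp [mul_sub, sub_mul, s1, s2, s3, s4, s3', s4', pP.1, pQ.1]
    have hV2 : V * Vᴴ = 1 := by
      rw [hV, ← Matrix.fromBlocks_one]
      simp only [V, Matrix.fromBlocks_multiply]
      congr 1 <;> simp [mul_sub, sub_mul, s1, s2, s3, s4, s3', s4', pP.1, pQ.1]
    refine ⟨N + N, by omega, by omega, Matrix.reindexAlgEquiv ℕ A finSumFinEquiv V, ?_, ?_⟩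
    · rw [Unitary.mem_iff, hstar, ← map_mul, ← map_mul, hV1, hV2, map_one]
      exact ⟨rfl, rfl⟩
    · rw [padTwo hpN, padTwo hqN, hstar, ← map_mul, ← map_mul]
      congr 1
      rw [hV]
      simp only [V, Matrix.fromBlocks_multiply]
      congr 1 <;>
        simp [mul_sub, sub_mul, s2, s3, pP.1, ← hP, ← hQ]

theorem isStarProjection_blockSum {m n : ℕ} {M : Matrix (Fin m) (Fin m) A}
    {M' : Matrix (Fin n) (Fin n) A} (h : IsStarProjection M) (h' : IsStarProjection M') :
    IsStarProjection (blockSum M M') := by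
  rw [isStarProjection_iff_matrix] at *
  constructor
  · simp [blockSum, Matrix.submatrix_mul_equiv, Matrix.fromBlocks_multiply, h.1, h'.1]
  · simp [blockSum, Matrix.fromBlocks_conjTranspose, h.2, h'.2]

/-- The projection `p ⊕ q`. -/
def MatProj.add (p q : MatProj A) : MatProj A where
  size := p.size + q.size
  mat := blockSum p.mat q.mat
  isStarProjection := isStarProjection_blockSum p.isStarProjection q.isStarProjection

/-- The empty projection, in `M_0(A)`. -/
def MatProj.zero (A : Type v) [Ring A] [StarRing A] : MatProj A where
  size := 0
  mat := 0
  isStarProjection := .zero _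

theorem partialIsomEquiv_blockSum {m n : ℕ} {M : Matrix (Fin m) (Fin m) A}
    {M' : Matrix (Fin n) (Fin n) A} (h : IsStarProjection M) (h' : IsStarProjection M') :
    PartialIsomEquiv (Matrix.fromBlocks M 0 0 M') (blockSum M M') := by
  refine PartialIsomEquiv.submatrix ?_ _
  rw [isStarProjection_iff_matrix] at *
  simp [Matrix.fromBlocks_multiply, Matrix.fromBlocks_conjTranspose, h.1, h.2, h'.1, h'.2]

theorem MatProj.idem (p : MatProj A) : p.mat * p.mat = p.mat := p.isStarProjection.isIdempotentElem

instance projSetoid (A : Type v) [Ring A] [StarRing A] : Setoid (MatProj A) where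
  r := ProjEquiv
  iseqv := by
    refine ⟨fun p => ?_, fun {p q} h => ?_, fun {p q r} h h' => ?_⟩
    · exact (projEquiv_iff _ _).2 (.refl p.isStarProjection)
    · exact (projEquiv_iff _ _).2 ((projEquiv_iff _ _).1 h).symm
    · exact (projEquiv_iff _ _).2 (((projEquiv_iff _ _).1 h).trans p.idem q.idem r.idem
        ((projEquiv_iff _ _).1 h'))

/-- `𝒫_∞(A)`: equivalence classes of projections in matrix algebras over `A`. -/
def ProjClasses (A : Type v) [Ring A] [StarRing A] : Type v := Quotient (projSetoid A)

/-- The class of a projection in `𝒫_∞(A)`. -/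
def ProjClasses.mk (p : MatProj A) : ProjClasses A := Quotient.mk (projSetoid A) p

theorem ProjClasses.mk_eq {p q : MatProj A} :
    ProjClasses.mk p = ProjClasses.mk q ↔ PartialIsomEquiv p.mat q.mat := by
  rw [← projEquiv_iff]
  exact Quotient.eq (r := projSetoid A)

theorem MatProj.blocks_idem (p q : MatProj A) :
    Matrix.fromBlocks p.mat 0 0 q.mat * Matrix.fromBlocks p.mat 0 0 q.mat =
      Matrix.fromBlocks p.mat 0 0 q.mat := by
  simp [Matrix.fromBlocks_multiply, p.idem, q.idem]

theorem MatProj.blocks_equiv (p q : MatProj A) :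
    PartialIsomEquiv (Matrix.fromBlocks p.mat 0 0 q.mat) (p.add q).mat :=
  partialIsomEquiv_blockSum p.isStarProjection q.isStarProjection

theorem MatProj.add_congr {p p' q q' : MatProj A} (h : ProjEquiv p p') (h' : ProjEquiv q q') :
    ProjEquiv (p.add q) (p'.add q') := by
  rw [projEquiv_iff] at *
  exact (p.blocks_equiv q).symm.trans (p.add q).idem (p.blocks_idem q) (p'.add q').idem
    ((h.fromBlocks h').trans (p.blocks_idem q) (p'.blocks_idem q') (p'.add q').idem
      (p'.blocks_equiv q'))

theorem PartialIsomEquiv.of_reindex {m n : ℕ} {P : Matrix (Fin m) (Fin m) A}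
    {Q : Matrix (Fin n) (Fin n) A} (hP : IsStarProjection P) (e : Fin n ≃ Fin m)
    (h : ∀ i j, Q i j = P (e i) (e j)) : PartialIsomEquiv P Q := by
  have : Q = P.submatrix e e := by
    ext i j
    exact h i j
  rw [this]
  exact PartialIsomEquiv.submatrix hP e

theorem blockSum_comm_equiv {m n : ℕ} {M : Matrix (Fin m) (Fin m) A}
    {M' : Matrix (Fin n) (Fin n) A} (h : IsStarProjection M) (h' : IsStarProjection M') :
    PartialIsomEquiv (blockSum M M') (blockSum M' M) := by
  refine PartialIsomEquiv.of_reindex (isStarProjection_blockSum h h')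
    (finSumFinEquiv.symm.trans ((Equiv.sumComm _ _).trans finSumFinEquiv)) ?_
  intro i j
  obtain ⟨i | i, rfl⟩ := finSumFinEquiv.surjective i <;>
  obtain ⟨j | j, rfl⟩ := finSumFinEquiv.surjective j <;>
  simp only [Equiv.trans_apply, Equiv.symm_apply_apply, blockSum_apply] <;> rfl

theorem blockSum_zero_equiv {n : ℕ} (Z : Matrix (Fin 0) (Fin 0) A) (hZ : IsStarProjection Z)
    {M : Matrix (Fin n) (Fin n) A} (h : IsStarProjection M) :
    PartialIsomEquiv (blockSum Z M) M := by
  refine PartialIsomEquiv.of_reindex (isStarProjection_blockSum hZ h)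
    ((Equiv.emptySum (Fin 0) (Fin n)).symm.trans finSumFinEquiv) ?_
  intro i j
  simp only [Equiv.trans_apply, blockSum_apply]
  rfl

theorem blockSum_assoc_equiv {m n l : ℕ} {M : Matrix (Fin m) (Fin m) A}
    {M' : Matrix (Fin n) (Fin n) A} {M'' : Matrix (Fin l) (Fin l) A} (h : IsStarProjection M)
    (h' : IsStarProjection M') (h'' : IsStarProjection M'') :
    PartialIsomEquiv (blockSum (blockSum M M') M'') (blockSum M (blockSum M' M'')) := by
  refine PartialIsomEquiv.of_reindex
    (isStarProjection_blockSum (isStarProjection_blockSum h h') h'')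
    (finSumFinEquiv.symm.trans (((Equiv.sumCongr (Equiv.refl _) finSumFinEquiv.symm).trans
      ((Equiv.sumAssoc _ _ _).symm.trans (Equiv.sumCongr finSumFinEquiv (Equiv.refl _)))).trans
        finSumFinEquiv)) ?_
  intro i j
  obtain ⟨i | i, rfl⟩ := finSumFinEquiv.surjective i <;>
  obtain ⟨j | j, rfl⟩ := finSumFinEquiv.surjective j <;>
  try (obtain ⟨i | i, rfl⟩ := finSumFinEquiv.surjective i) <;>
  try (obtain ⟨j | j, rfl⟩ := finSumFinEquiv.surjective j)
  all_goals
    (first | (obtain ⟨j | j, rfl⟩ := finSumFinEquiv.surjective j) | skip) <;>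
    simp [blockSum_apply, -finSumFinEquiv_apply_left, -finSumFinEquiv_apply_right]

/-- Addition of classes of projections is induced by the block sum. -/
instance : Add (ProjClasses A) :=
  ⟨Quotient.map₂ MatProj.add fun _ _ h _ _ h' => MatProj.add_congr h h'⟩

instance : Zero (ProjClasses A) := ⟨ProjClasses.mk (MatProj.zero A)⟩

theorem ProjClasses.mk_add (p q : MatProj A) :
    ProjClasses.mk p + ProjClasses.mk q = ProjClasses.mk (p.add q) := rfl

protected theorem ProjClasses.add_comm' (a b : ProjClasses A) : a + b = b + a := by
  obtain ⟨p⟩ := a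
  obtain ⟨q⟩ := b
  exact ProjClasses.mk_eq.2 (blockSum_comm_equiv p.isStarProjection q.isStarProjection)

protected theorem ProjClasses.zero_add' (a : ProjClasses A) : 0 + a = a := by
  obtain ⟨p⟩ := a
  exact ProjClasses.mk_eq.2
    (blockSum_zero_equiv _ (MatProj.zero A).isStarProjection p.isStarProjection)

protected theorem ProjClasses.add_assoc' (a b c : ProjClasses A) : a + b + c = a + (b + c) := by
  obtain ⟨p⟩ := a
  obtain ⟨q⟩ := b
  obtain ⟨r⟩ := c
  exact ProjClasses.mk_eq.2
    (blockSum_assoc_equiv p.isStarProjection q.isStarProjection r.isStarProjection)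

instance : AddCommMonoid (ProjClasses A) where
  nsmul := nsmulRec
  add_assoc := ProjClasses.add_assoc'
  zero_add := ProjClasses.zero_add'
  add_zero a := (ProjClasses.add_comm' a 0).trans (ProjClasses.zero_add' a)
  add_comm := ProjClasses.add_comm'

/-- `KO₀(A) = Groth(𝒫_∞(A))` for a unital real C*-algebra `A` (only the `*`-ring structure
of `A` enters). -/
abbrev KO0 (A : Type v) [Ring A] [StarRing A] : Type v :=
  Algebra.GrothendieckAddGroup (ProjClasses A)

/-- The class `[p] ∈ KO₀(A)` of a projection `p`. -/
def KO0.of (p : MatProj A) : KO0 A := Algebra.GrothendieckAddGroup.of (ProjClasses.mk p)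

variable {B : Type w} [Ring B] [StarRing B] [Algebra ℝ A] [Algebra ℝ B]

/-- The projection `f(p) ∈ M_n(B)`, for a unital `*`-homomorphism `f : A → B`. -/
def MatProj.map (f : A →⋆ₐ[ℝ] B) (p : MatProj A) : MatProj B where
  size := p.size
  mat := p.mat.map f
  isStarProjection := by
    obtain ⟨h1, h2⟩ := (isStarProjection_iff_matrix _).1 p.isStarProjection
    rw [isStarProjection_iff_matrix, ← Matrix.map_mul, h1]
    refine ⟨rfl, ?_⟩
    conv_rhs => rw [← h2]
    ext i j
    simp [map_star]

theorem PartialIsomEquiv.map {m n : ℕ} (f : A →⋆ₐ[ℝ] B) {P : Matrix (Fin m) (Fin m) A}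
    {Q : Matrix (Fin n) (Fin n) A} (h : PartialIsomEquiv P Q) :
    PartialIsomEquiv (P.map f) (Q.map f) := by
  obtain ⟨S, h1, h2⟩ := h
  have hS : (S.map f)ᴴ = Sᴴ.map f := by
    ext i j
    simp [map_star]
  exact ⟨S.map f, by rw [hS, ← Matrix.map_mul, h1], by rw [hS, ← Matrix.map_mul, h2]⟩

theorem MatProj.map_congr (f : A →⋆ₐ[ℝ] B) {p q : MatProj A} (h : ProjEquiv p q) :
    ProjEquiv (p.map f) (q.map f) :=
  (projEquiv_iff _ _).2 (((projEquiv_iff _ _).1 h).map f)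

theorem MatProj.map_add (f : A →⋆ₐ[ℝ] B) (p q : MatProj A) :
    (p.add q).map f = (p.map f).add (q.map f) := by
  simp only [MatProj.map, MatProj.add, blockSum_map _ _ f (map_zero f)]

theorem MatProj.map_zero (f : A →⋆ₐ[ℝ] B) : (MatProj.zero A).map f = MatProj.zero B := by
  simp only [MatProj.map, MatProj.zero, Matrix.map_zero _ (_root_.map_zero f)]

/-- The map `𝒫_∞(A) → 𝒫_∞(B)` induced by a unital `*`-homomorphism. -/
def ProjClasses.map (f : A →⋆ₐ[ℝ] B) : ProjClasses A →+ ProjClasses B where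
  toFun := Quotient.map (MatProj.map f) fun _ _ h => MatProj.map_congr f h
  map_zero' := congrArg ProjClasses.mk (MatProj.map_zero f)
  map_add' := by
    rintro ⟨p⟩ ⟨q⟩
    exact congrArg ProjClasses.mk (MatProj.map_add f p q)

/-- The induced homomorphism `f_* : KO₀(A) → KO₀(B)`, `f_*[p] = [f(p)]`. -/
def KO0.map (f : A →⋆ₐ[ℝ] B) : KO0 A →+ KO0 B :=
  Algebra.GrothendieckAddGroup.lift (Algebra.GrothendieckAddGroup.of.comp (ProjClasses.map f))

theorem KO0.map_of (f : A →⋆ₐ[ℝ] B) (p : MatProj A) :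
    KO0.map f (KO0.of p) = KO0.of (p.map f) :=
  DFunLike.congr_fun (Algebra.GrothendieckAddGroup.lift.symm_apply_apply
    (Algebra.GrothendieckAddGroup.of.comp (ProjClasses.map f))) (ProjClasses.mk p)

theorem grothHom_ext {M : Type*} [AddCommMonoid M] {G : Type*} [AddCommGroup G]
    {f g : Algebra.GrothendieckAddGroup M →+ G}
    (h : ∀ m, f (Algebra.GrothendieckAddGroup.of m) = g (Algebra.GrothendieckAddGroup.of m)) :
    f = g :=
  Algebra.GrothendieckAddGroup.lift.symm.injective (AddMonoidHom.ext h)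

theorem KO0.map_comp {C : Type*} [Ring C] [StarRing C] [Algebra ℝ C] (g : B →⋆ₐ[ℝ] C)
    (f : A →⋆ₐ[ℝ] B) : KO0.map (g.comp f) = (KO0.map g).comp (KO0.map f) := by
  refine grothHom_ext fun m => ?_
  obtain ⟨p⟩ := m
  change KO0.map _ (KO0.of p) = KO0.map g (KO0.map f (KO0.of p))
  rw [KO0.map_of, KO0.map_of, KO0.map_of]
  rfl

end Projections


section NonUnital

variable {A : Type v} [NonUnitalRing A] [StarRing A] [Module ℝ A] [IsScalarTower ℝ A A]
  [SMulCommClass ℝ A A] [StarModule ℝ A]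
  {B : Type w} [NonUnitalRing B] [StarRing B] [Module ℝ B] [IsScalarTower ℝ B B]
  [SMulCommClass ℝ B B] [StarModule ℝ B]

/-- The canonical map `π : A⁺ → ℝ`, `(a, r) ↦ r`. -/
def unitizationProj (A : Type v) [NonUnitalRing A] [StarRing A] [Module ℝ A]
    [IsScalarTower ℝ A A] [SMulCommClass ℝ A A] [StarModule ℝ A] : Unitization ℝ A →⋆ₐ[ℝ] ℝ :=
  { Unitization.fstHom ℝ A with map_star' := fun _ => rfl }

/-- `KO₀(A) = ker (π_* : KO₀(A⁺) → KO₀(ℝ))` for an arbitrary, possibly non-unital, real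
C*-algebra `A`, with `A⁺ = A ⊕ ℝ` its unitization. -/
def KO0nonunital (A : Type v) [NonUnitalRing A] [StarRing A] [Module ℝ A]
    [IsScalarTower ℝ A A] [SMulCommClass ℝ A A] [StarModule ℝ A] :
    AddSubgroup (KO0 (Unitization ℝ A)) :=
  (KO0.map (unitizationProj A)).ker

/-- The homomorphism `KO₀(A) → KO₀(B)` induced by a `*`-homomorphism `f : A → B`: the
restriction of `(f⁺)_*`. -/
def KO0nonunital.map (f : A →⋆ₙₐ[ℝ] B) : KO0nonunital A →+ KO0nonunital B :=
  ((KO0.map (Unitization.starMap f)).comp (KO0nonunital A).subtype).codRestrict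
    (KO0nonunital B) fun z => by
      have h : (unitizationProj B).comp (Unitization.starMap f) = unitizationProj A := by
        ext a
        change (Unitization.starMap f (a : Unitization ℝ A)).fst = (a : Unitization ℝ A).fst
        simp
      have hz : KO0.map (unitizationProj A) (z : KO0 (Unitization ℝ A)) = 0 := z.2
      change KO0.map (unitizationProj B) (KO0.map (Unitization.starMap f) z) = 0
      rw [← AddMonoidHom.comp_apply, ← KO0.map_comp, h, hz]

end NonUnital

/-! ## Complex vector bundles with involution -/

/-- An involution `τ` of a topological space: a continuous map with `τ ∘ τ = id`. -/
structure TopInvolution (X : Type u) [TopologicalSpace X] where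
  toFun : X → X
  continuous_toFun : Continuous toFun
  involutive : Function.Involutive toFun

instance (X : Type u) [TopologicalSpace X] : CoeFun (TopInvolution X) (fun _ => X → X) :=
  ⟨TopInvolution.toFun⟩

/-- A map of spaces with involution: a continuous map `f` with `f ∘ τ₁ = τ₂ ∘ f`. -/
structure EquivariantMap {X₁ : Type u₁} {X₂ : Type u₂} [TopologicalSpace X₁]
    [TopologicalSpace X₂] (τ₁ : TopInvolution X₁) (τ₂ : TopInvolution X₂) where
  toFun : X₁ → X₂
  continuous_toFun : Continuous toFun
  map_involution : ∀ x, toFun (τ₁ x) = τ₂ (toFun x)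

instance {X₁ : Type u₁} {X₂ : Type u₂} [TopologicalSpace X₁] [TopologicalSpace X₂]
    (τ₁ : TopInvolution X₁) (τ₂ : TopInvolution X₂) :
    CoeFun (EquivariantMap τ₁ τ₂) (fun _ => X₁ → X₂) :=
  ⟨EquivariantMap.toFun⟩

/-- The composite of two maps of spaces with involution. -/
def EquivariantMap.comp {X₁ : Type u₁} {X₂ : Type u₂} {X₃ : Type u₃} [TopologicalSpace X₁]
    [TopologicalSpace X₂] [TopologicalSpace X₃] {τ₁ : TopInvolution X₁} {τ₂ : TopInvolution X₂}
    {τ₃ : TopInvolution X₃} (g : EquivariantMap τ₂ τ₃) (f : EquivariantMap τ₁ τ₂) :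
    EquivariantMap τ₁ τ₃ where
  toFun := fun x => g (f x)
  continuous_toFun := g.continuous_toFun.comp f.continuous_toFun
  map_involution x := by rw [f.map_involution, g.map_involution]

/-- The total space of a family of fibres, as a set. Its topology is part of the structure of a
bundle. -/
structure Total {X : Type u} (E : X → Type w) where
  base : X
  vec : E base

/-- Local triviality of a family of complex vector spaces: every point has an open neighbourhood
`U` with a homeomorphism `E|_U ≅ U × ℂ^k` over `U` which is `ℂ`-linear on each fibre. The rank `k`
may depend on the point. -/
def IsLocallyTrivial {X : Type u} [TopologicalSpace X] (E : X → Type w)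
    [∀ x, AddCommGroup (E x)] [∀ x, Module ℂ (E x)] [TopologicalSpace (Total E)] : Prop :=
  ∀ x₀ : X, ∃ (U : Set X) (k : ℕ) (φ : ∀ x : U, E x ≃ₗ[ℂ] (Fin k → ℂ)),
    IsOpen U ∧ x₀ ∈ U ∧
    Continuous (fun e : {e : Total E // e.base ∈ U} => φ ⟨e.1.base, e.2⟩ e.1.vec) ∧
    Continuous (fun q : U × (Fin k → ℂ) => (⟨q.1, (φ q.1).symm q.2⟩ : Total E))

/-- A complex vector bundle with involution `(E, σ)` over `(X, τ)`. The conjugate-linear map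
`σ : E_x → E_{τ x}` is written `conj h : E_x → E_y` for `h : y = τ x`. -/
structure InvBundle {X : Type u} [TopologicalSpace X] (τ : TopInvolution X) where
  fiber : X → Type w
  [addCommGroup : ∀ x, AddCommGroup (fiber x)]
  [module : ∀ x, Module ℂ (fiber x)]
  [topology : TopologicalSpace (Total fiber)]
  continuous_base : Continuous (Total.base : Total fiber → X)
  isLocallyTrivial : IsLocallyTrivial fiber
  conj : ∀ {x y : X}, y = τ x → (fiber x →ₛₗ[starRingEnd ℂ] fiber y)
  conj_conj : ∀ {x y : X} (h : y = τ x) (h' : x = τ y) (v : fiber x), conj h' (conj h v) = v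
  continuous_conj :
    Continuous (fun e : Total fiber => (⟨τ e.base, conj rfl e.vec⟩ : Total fiber))

attribute [instance] InvBundle.addCommGroup InvBundle.module InvBundle.topology

section Bundles

variable {X : Type u} [TopologicalSpace X] {τ : TopInvolution X}

/-- An isomorphism of complex vector bundles with involution over `(X, τ)`: a homeomorphism of
total spaces over `X` which is `ℂ`-linear on the fibres and commutes with the involutions. -/
structure InvBundle.Iso (E E' : InvBundle.{u, w} τ) where
  equiv : ∀ x, E.fiber x ≃ₗ[ℂ] E'.fiber x
  continuous_to : Continuous (fun e : Total E.fiber => (⟨e.base, equiv e.base e.vec⟩ :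
    Total E'.fiber))
  continuous_inv : Continuous (fun e : Total E'.fiber => (⟨e.base, (equiv e.base).symm e.vec⟩ :
    Total E.fiber))
  map_conj : ∀ {x y : X} (h : y = τ x) (v : E.fiber x),
    equiv y (E.conj h v) = E'.conj h (equiv x v)

instance bundleSetoid (τ : TopInvolution X) : Setoid (InvBundle.{u, w} τ) where
  r E E' := Nonempty (InvBundle.Iso E E')
  iseqv := by
    refine ⟨fun E => ⟨⟨fun x => .refl ℂ _, ?_, ?_, ?_⟩⟩, ?_, ?_⟩
    · exact continuous_id
    · exact continuous_id
    · exact fun _ _ => rfl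
    · rintro E E' ⟨i⟩
      refine ⟨⟨fun x => (i.equiv x).symm, i.continuous_inv, i.continuous_to, ?_⟩⟩
      intro x y h v
      rw [LinearEquiv.symm_apply_eq, i.map_conj, LinearEquiv.apply_symm_apply]
    · rintro E E' E'' ⟨i⟩ ⟨j⟩
      refine ⟨⟨fun x => (i.equiv x).trans (j.equiv x), j.continuous_to.comp i.continuous_to,
        i.continuous_inv.comp j.continuous_inv, ?_⟩⟩
      intro x y h v
      simp [i.map_conj, j.map_conj]

/-- `Vect(X, τ)`: isomorphism classes of complex vector bundles with involution. -/
def Vect (τ : TopInvolution X) : Type (max u (w + 1)) :=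
  Quotient (bundleSetoid.{u, w} τ)

/-- The isomorphism class of a bundle. -/
def Vect.mk (E : InvBundle.{u, w} τ) : Vect.{u, w} τ := Quotient.mk (bundleSetoid τ) E

theorem Vect.mk_eq {E E' : InvBundle.{u, w} τ} :
    Vect.mk E = Vect.mk E' ↔ Nonempty (InvBundle.Iso E E') :=
  Quotient.eq (r := bundleSetoid τ)

/-- The pair of vectors which makes up a vector of a Whitney sum. -/
def sumToProd {E E' : X → Type w} (e : Total (fun x => E x × E' x)) : Total E × Total E' :=
  (⟨e.base, e.vec.1⟩, ⟨e.base, e.vec.2⟩)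

/-- The direct (Whitney) sum `(E ⊕ E', σ ⊕ σ')`, with `(E ⊕ E')_x = E_x ⊕ E'_x` and with the
topology of a subspace of `E × E'` on the total space. -/
def InvBundle.sum (E E' : InvBundle.{u, w} τ) : InvBundle.{u, w} τ where
  fiber x := E.fiber x × E'.fiber x
  topology := TopologicalSpace.induced sumToProd inferInstance
  continuous_base :=
    let _ : TopologicalSpace (Total fun x => E.fiber x × E'.fiber x) :=
      TopologicalSpace.induced sumToProd inferInstance
    E.continuous_base.comp (continuous_fst.comp (f := sumToProd) continuous_induced_dom)
  isLocallyTrivial x₀ := by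
    let : TopologicalSpace (Total fun x => E.fiber x × E'.fiber x) :=
      TopologicalSpace.induced sumToProd inferInstance
    have hc : Continuous (sumToProd : Total (fun x => E.fiber x × E'.fiber x) → _) :=
      continuous_induced_dom
    obtain ⟨U, k, φ, hU, hx, h1, h2⟩ := E.isLocallyTrivial x₀
    obtain ⟨U', k', φ', hU', hx', h1', h2'⟩ := E'.isLocallyTrivial x₀
    let ψ : ((Fin k → ℂ) × (Fin k' → ℂ)) ≃ₗ[ℂ] (Fin (k + k') → ℂ) :=
      (LinearEquiv.sumArrowLequivProdArrow (Fin k) (Fin k') ℂ ℂ).symm.trans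
        (LinearEquiv.funCongrLeft ℂ ℂ finSumFinEquiv.symm)
    have hψ : Continuous ψ := ψ.toLinearMap.continuous_of_finiteDimensional
    have hψ' : Continuous ψ.symm := ψ.symm.toLinearMap.continuous_of_finiteDimensional
    refine ⟨U ∩ U', k + k', fun x =>
      (LinearEquiv.prodCongr (φ ⟨x.1, x.2.1⟩) (φ' ⟨x.1, x.2.2⟩)).trans ψ, hU.inter hU',
      ⟨hx, hx'⟩, ?_, ?_⟩
    · refine hψ.comp (Continuous.prodMk ?_ ?_)
      · exact h1.comp (Continuous.subtype_mk
          (continuous_fst.comp (hc.comp continuous_subtype_val)) fun e => e.2.1)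
      · exact h1'.comp (Continuous.subtype_mk
          (continuous_snd.comp (hc.comp continuous_subtype_val)) fun e => e.2.2)
    · refine continuous_induced_rng.2 (Continuous.prodMk ?_ ?_)
      · exact h2.comp (Continuous.prodMk
          (Continuous.subtype_mk (continuous_subtype_val.comp continuous_fst) fun q => q.1.2.1)
          (continuous_fst.comp (hψ'.comp continuous_snd)))
      · exact h2'.comp (Continuous.prodMk
          (Continuous.subtype_mk (continuous_subtype_val.comp continuous_fst) fun q => q.1.2.2)
          (continuous_snd.comp (hψ'.comp continuous_snd)))
  conj {x y} h :=
    { toFun := fun v => (E.conj h v.1, E'.conj h v.2)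
      map_add' := fun v w => by simp
      map_smul' := fun c v => by simp }
  conj_conj h h' v := Prod.ext (E.conj_conj h h' v.1) (E'.conj_conj h h' v.2)
  continuous_conj := by
    let : TopologicalSpace (Total fun x => E.fiber x × E'.fiber x) :=
      TopologicalSpace.induced sumToProd inferInstance
    have hc : Continuous (sumToProd : Total (fun x => E.fiber x × E'.fiber x) → _) :=
      continuous_induced_dom
    exact continuous_induced_rng.2 (Continuous.prodMk
      (E.continuous_conj.comp (continuous_fst.comp hc))
      (E'.continuous_conj.comp (continuous_snd.comp hc)))

/-- The zero bundle `X × 0`. -/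
def InvBundle.zero (τ : TopInvolution X) : InvBundle.{u, w} τ where
  fiber _ := PUnit.{w + 1}
  topology := TopologicalSpace.induced Total.base inferInstance
  continuous_base := continuous_induced_dom
  isLocallyTrivial x₀ := by
    let : TopologicalSpace (Total fun _ : X => PUnit.{w + 1}) :=
      TopologicalSpace.induced Total.base inferInstance
    refine ⟨Set.univ, 0, fun _ => 0, isOpen_univ, trivial, ?_, ?_⟩
    · exact continuous_const
    · exact continuous_induced_rng.2 (continuous_subtype_val.comp continuous_fst)
  conj _ := 0
  conj_conj _ _ _ := rfl
  continuous_conj := by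
    let : TopologicalSpace (Total fun _ : X => PUnit.{w + 1}) :=
      TopologicalSpace.induced Total.base inferInstance
    exact continuous_induced_rng.2 (τ.continuous_toFun.comp continuous_induced_dom)

theorem InvBundle.continuous_sum_fst (E E' : InvBundle.{u, w} τ) :
    Continuous (fun e : Total (E.sum E').fiber => (⟨e.base, e.vec.1⟩ : Total E.fiber)) :=
  continuous_fst.comp (f := fun e : Total (E.sum E').fiber =>
    sumToProd (E := E.fiber) (E' := E'.fiber) e) continuous_induced_dom

theorem InvBundle.continuous_sum_snd (E E' : InvBundle.{u, w} τ) :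
    Continuous (fun e : Total (E.sum E').fiber => (⟨e.base, e.vec.2⟩ : Total E'.fiber)) :=
  continuous_snd.comp (f := fun e : Total (E.sum E').fiber =>
    sumToProd (E := E.fiber) (E' := E'.fiber) e) continuous_induced_dom

theorem InvBundle.continuous_to_sum {Z : Type*} [TopologicalSpace Z] (E E' : InvBundle.{u, w} τ)
    (b : Z → X) (s : ∀ z, E.fiber (b z)) (s' : ∀ z, E'.fiber (b z))
    (h : Continuous (fun z => (⟨b z, s z⟩ : Total E.fiber)))
    (h' : Continuous (fun z => (⟨b z, s' z⟩ : Total E'.fiber))) :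
    Continuous (fun z => (⟨b z, (s z, s' z)⟩ : Total (E.sum E').fiber)) :=
  continuous_induced_rng.2 (Continuous.prodMk h h')

theorem InvBundle.sum_congr {E₁ E₂ E₁' E₂' : InvBundle.{u, w} τ} (i : InvBundle.Iso E₁ E₂)
    (i' : InvBundle.Iso E₁' E₂') : Nonempty (InvBundle.Iso (E₁.sum E₁') (E₂.sum E₂')) :=
  ⟨{ equiv := fun x => LinearEquiv.prodCongr (i.equiv x) (i'.equiv x)
     continuous_to := E₂.continuous_to_sum E₂' _ _ _
      (i.continuous_to.comp (E₁.continuous_sum_fst E₁'))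
      (i'.continuous_to.comp (E₁.continuous_sum_snd E₁'))
     continuous_inv := E₁.continuous_to_sum E₁' _ _ _
      (i.continuous_inv.comp (E₂.continuous_sum_fst E₂'))
      (i'.continuous_inv.comp (E₂.continuous_sum_snd E₂'))
     map_conj := fun h v => Prod.ext (i.map_conj h v.1) (i'.map_conj h v.2) }⟩

theorem InvBundle.sum_comm (E E' : InvBundle.{u, w} τ) :
    Nonempty (InvBundle.Iso (E.sum E') (E'.sum E)) :=
  ⟨{ equiv := fun x => LinearEquiv.prodComm ℂ (E.fiber x) (E'.fiber x)
     continuous_to := E'.continuous_to_sum E _ _ _ (E.continuous_sum_snd E')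
      (E.continuous_sum_fst E')
     continuous_inv := E.continuous_to_sum E' _ _ _ (E'.continuous_sum_snd E)
      (E'.continuous_sum_fst E)
     map_conj := fun _ _ => rfl }⟩

theorem InvBundle.zero_sum (E : InvBundle.{u, w} τ) :
    Nonempty (InvBundle.Iso ((InvBundle.zero τ).sum E) E) :=
  ⟨{ equiv := fun _ =>
      { toFun := fun v => v.2
        map_add' := fun _ _ => rfl
        map_smul' := fun _ _ => rfl
        invFun := fun v => (PUnit.unit, v)
        left_inv := fun _ => rfl
        right_inv := fun _ => rfl }
     continuous_to := (InvBundle.zero τ).continuous_sum_snd E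
     continuous_inv := (InvBundle.zero τ).continuous_to_sum E _ _ _
      (continuous_induced_rng.2 E.continuous_base) continuous_id
     map_conj := fun _ _ => rfl }⟩

theorem InvBundle.sum_assoc (E E' E'' : InvBundle.{u, w} τ) :
    Nonempty (InvBundle.Iso ((E.sum E').sum E'') (E.sum (E'.sum E''))) :=
  ⟨{ equiv := fun x => LinearEquiv.prodAssoc ℂ (E.fiber x) (E'.fiber x) (E''.fiber x)
     continuous_to := E.continuous_to_sum (E'.sum E'') _ _ _
      ((E.continuous_sum_fst E').comp ((E.sum E').continuous_sum_fst E''))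
      (E'.continuous_to_sum E'' _ _ _
        ((E.continuous_sum_snd E').comp ((E.sum E').continuous_sum_fst E''))
        ((E.sum E').continuous_sum_snd E''))
     continuous_inv := (E.sum E').continuous_to_sum E'' _ _ _
      (E.continuous_to_sum E' _ _ _ (E.continuous_sum_fst (E'.sum E''))
        ((E'.continuous_sum_fst E'').comp (E.continuous_sum_snd (E'.sum E''))))
      ((E'.continuous_sum_snd E'').comp (E.continuous_sum_snd (E'.sum E'')))
     map_conj := fun _ _ => rfl }⟩

/-- Addition on `Vect(X, τ)` is induced by the direct sum of bundles. -/
instance : Add (Vect.{u, w} τ) :=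
  ⟨Quotient.map₂ InvBundle.sum fun _ _ ⟨i⟩ _ _ ⟨j⟩ => InvBundle.sum_congr i j⟩

instance : Zero (Vect.{u, w} τ) := ⟨Vect.mk (InvBundle.zero τ)⟩

protected theorem Vect.add_comm' (a b : Vect.{u, w} τ) : a + b = b + a := by
  obtain ⟨E⟩ := a
  obtain ⟨E'⟩ := b
  exact Vect.mk_eq.2 (E.sum_comm E')

protected theorem Vect.zero_add' (a : Vect.{u, w} τ) : 0 + a = a := by
  obtain ⟨E⟩ := a
  exact Vect.mk_eq.2 E.zero_sum

protected theorem Vect.add_assoc' (a b c : Vect.{u, w} τ) : a + b + c = a + (b + c) := by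
  obtain ⟨E⟩ := a
  obtain ⟨E'⟩ := b
  obtain ⟨E''⟩ := c
  exact Vect.mk_eq.2 (E.sum_assoc E' E'')

instance : AddCommMonoid (Vect.{u, w} τ) where
  nsmul := nsmulRec
  add_assoc := Vect.add_assoc'
  zero_add := Vect.zero_add'
  add_zero a := (Vect.add_comm' a 0).trans (Vect.zero_add' a)
  add_comm := Vect.add_comm'

/-- `KR⁰(X, τ) = Groth(Vect(X, τ))`, for compact `X`. -/
abbrev KR0 (τ : TopInvolution X) : Type (max u (w + 1)) :=
  Algebra.GrothendieckAddGroup (Vect.{u, w} τ)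

/-- The class `[E] ∈ KR⁰(X, τ)` of a bundle. -/
def KR0.of (E : InvBundle.{u, w} τ) : KR0.{u, w} τ :=
  Algebra.GrothendieckAddGroup.of (Vect.mk E)

end Bundles

section Pullback

variable {X₁ : Type u₁} {X₂ : Type u₂} {X₃ : Type u₃} [TopologicalSpace X₁]
  [TopologicalSpace X₂] [TopologicalSpace X₃] {τ₁ : TopInvolution X₁} {τ₂ : TopInvolution X₂}
  {τ₃ : TopInvolution X₃}

/-- The inclusion of the total space of `f^*E` in `X₁ × E`. -/
def pullbackToProd (f : X₁ → X₂) {E : X₂ → Type w} (e : Total (fun x => E (f x))) :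
    X₁ × Total E :=
  (e.base, ⟨f e.base, e.vec⟩)

/-- The pullback `f^*E`, with `(f^*E)_x = E_{f x}` and with the topology of a subspace of
`X₁ × E` on the total space. -/
def InvBundle.pullback (f : EquivariantMap τ₁ τ₂) (E : InvBundle.{u₂, w} τ₂) :
    InvBundle.{u₁, w} τ₁ where
  fiber x := E.fiber (f x)
  topology := TopologicalSpace.induced (pullbackToProd f) inferInstance
  continuous_base :=
    let _ : TopologicalSpace (Total fun x => E.fiber (f x)) :=
      TopologicalSpace.induced (pullbackToProd f) inferInstance
    continuous_fst.comp (f := pullbackToProd f) continuous_induced_dom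
  isLocallyTrivial x₀ := by
    let : TopologicalSpace (Total fun x => E.fiber (f x)) :=
      TopologicalSpace.induced (pullbackToProd f) inferInstance
    have hc : Continuous (pullbackToProd f : Total (fun x => E.fiber (f x)) → _) :=
      continuous_induced_dom
    obtain ⟨U, k, φ, hU, hx, h1, h2⟩ := E.isLocallyTrivial (f x₀)
    refine ⟨f ⁻¹' U, k, fun x => φ ⟨f x.1, x.2⟩, hU.preimage f.continuous_toFun, hx, ?_, ?_⟩
    · exact h1.comp (Continuous.subtype_mk
        (continuous_snd.comp (hc.comp continuous_subtype_val)) fun e => e.2)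
    · refine continuous_induced_rng.2 (Continuous.prodMk
        (continuous_subtype_val.comp continuous_fst) ?_)
      exact h2.comp (Continuous.prodMk (Continuous.subtype_mk (f.continuous_toFun.comp
        (continuous_subtype_val.comp continuous_fst)) fun q => q.1.2) continuous_snd)
  conj {x y} h := E.conj (by rw [h, f.map_involution])
  conj_conj _ _ v := E.conj_conj _ _ v
  continuous_conj := by
    let : TopologicalSpace (Total fun x => E.fiber (f x)) :=
      TopologicalSpace.induced (pullbackToProd f) inferInstance
    have hc : Continuous (pullbackToProd f : Total (fun x => E.fiber (f x)) → _) :=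
      continuous_induced_dom
    refine continuous_induced_rng.2 (Continuous.prodMk
      (τ₁.continuous_toFun.comp (continuous_fst.comp hc)) ?_)
    have key : ∀ (y : X₂) (e : Total (fun x => E.fiber (f x))) (h : y = τ₂ (f e.base)),
        (⟨y, E.conj h e.vec⟩ : Total E.fiber) = ⟨τ₂ (f e.base), E.conj rfl e.vec⟩ := by
      rintro y e rfl
      rfl
    have := E.continuous_conj.comp (continuous_snd.comp hc)
    convert this using 2 with e
    exact key _ e _

theorem InvBundle.continuous_pullback_snd (f : EquivariantMap τ₁ τ₂) (E : InvBundle.{u₂, w} τ₂) :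
    Continuous (fun e : Total (E.pullback f).fiber => (⟨f e.base, e.vec⟩ : Total E.fiber)) :=
  continuous_snd.comp (f := fun e : Total (E.pullback f).fiber =>
    pullbackToProd f (E := E.fiber) e) continuous_induced_dom

theorem InvBundle.continuous_to_pullback {Z : Type*} [TopologicalSpace Z]
    (f : EquivariantMap τ₁ τ₂) (E : InvBundle.{u₂, w} τ₂) (b : Z → X₁)
    (s : ∀ z, E.fiber (f (b z))) (hb : Continuous b)
    (h : Continuous (fun z => (⟨f (b z), s z⟩ : Total E.fiber))) :
    Continuous (fun z => (⟨b z, s z⟩ : Total (E.pullback f).fiber)) :=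
  continuous_induced_rng.2 (Continuous.prodMk hb h)

theorem InvBundle.pullback_congr (f : EquivariantMap τ₁ τ₂) {E E' : InvBundle.{u₂, w} τ₂}
    (i : InvBundle.Iso E E') : Nonempty (InvBundle.Iso (E.pullback f) (E'.pullback f)) :=
  ⟨{ equiv := fun x => i.equiv (f x)
     continuous_to := E'.continuous_to_pullback f _ _ (E.pullback f).continuous_base
      (i.continuous_to.comp (E.continuous_pullback_snd f))
     continuous_inv := E.continuous_to_pullback f _ _ (E'.pullback f).continuous_base
      (i.continuous_inv.comp (E'.continuous_pullback_snd f))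
     map_conj := fun _ v => i.map_conj _ v }⟩

theorem InvBundle.pullback_sum (f : EquivariantMap τ₁ τ₂) (E E' : InvBundle.{u₂, w} τ₂) :
    Nonempty (InvBundle.Iso ((E.sum E').pullback f) ((E.pullback f).sum (E'.pullback f))) :=
  ⟨{ equiv := fun _ => LinearEquiv.refl ℂ _
     continuous_to := (E.pullback f).continuous_to_sum (E'.pullback f) _ _ _
      (E.continuous_to_pullback f _ _ ((E.sum E').pullback f).continuous_base
        ((E.continuous_sum_fst E').comp ((E.sum E').continuous_pullback_snd f)))
      (E'.continuous_to_pullback f _ _ ((E.sum E').pullback f).continuous_base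
        ((E.continuous_sum_snd E').comp ((E.sum E').continuous_pullback_snd f)))
     continuous_inv := (E.sum E').continuous_to_pullback f _ _
      ((E.pullback f).sum (E'.pullback f)).continuous_base
      (E.continuous_to_sum E' _ _ _
        ((E.continuous_pullback_snd f).comp ((E.pullback f).continuous_sum_fst (E'.pullback f)))
        ((E'.continuous_pullback_snd f).comp
          ((E.pullback f).continuous_sum_snd (E'.pullback f))))
     map_conj := fun _ _ => rfl }⟩

theorem InvBundle.pullback_zero (f : EquivariantMap τ₁ τ₂) :
    Nonempty (InvBundle.Iso ((InvBundle.zero.{u₂, w} τ₂).pullback f) (InvBundle.zero τ₁)) :=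
  ⟨{ equiv := fun _ => LinearEquiv.refl ℂ PUnit.{w + 1}
     continuous_to := continuous_induced_rng.2
      ((InvBundle.zero.{u₂, w} τ₂).pullback f).continuous_base
     continuous_inv := (InvBundle.zero τ₂).continuous_to_pullback f _ _
      (InvBundle.zero τ₁).continuous_base
      (continuous_induced_rng.2 (f.continuous_toFun.comp (InvBundle.zero τ₁).continuous_base))
     map_conj := fun _ _ => rfl }⟩

theorem InvBundle.pullback_comp (g : EquivariantMap τ₂ τ₃) (f : EquivariantMap τ₁ τ₂)
    (E : InvBundle.{u₃, w} τ₃) :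
    Nonempty (InvBundle.Iso (E.pullback (g.comp f)) ((E.pullback g).pullback f)) :=
  ⟨{ equiv := fun _ => LinearEquiv.refl ℂ _
     continuous_to := (E.pullback g).continuous_to_pullback f _ _
      (E.pullback (g.comp f)).continuous_base
      (E.continuous_to_pullback g _ _
        (f.continuous_toFun.comp (E.pullback (g.comp f)).continuous_base)
        (E.continuous_pullback_snd (g.comp f)))
     continuous_inv := E.continuous_to_pullback (g.comp f) _ _
      ((E.pullback g).pullback f).continuous_base
      ((E.continuous_pullback_snd g).comp ((E.pullback g).continuous_pullback_snd f))
     map_conj := fun _ _ => rfl }⟩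

/-- The map `Vect(X₂, τ₂) → Vect(X₁, τ₁)` induced by pullback. -/
def Vect.map (f : EquivariantMap τ₁ τ₂) : Vect.{u₂, w} τ₂ →+ Vect.{u₁, w} τ₁ where
  toFun := Quotient.map (InvBundle.pullback f) fun _ _ ⟨i⟩ => InvBundle.pullback_congr f i
  map_zero' := Vect.mk_eq.2 (InvBundle.pullback_zero f)
  map_add' := by
    rintro ⟨E⟩ ⟨E'⟩
    exact Vect.mk_eq.2 (InvBundle.pullback_sum f E E')

/-- The induced homomorphism `f^* : KR⁰(X₂, τ₂) → KR⁰(X₁, τ₁)`, `f^*[E] = [f^*E]`. -/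
def KR0.map (f : EquivariantMap τ₁ τ₂) : KR0.{u₂, w} τ₂ →+ KR0.{u₁, w} τ₁ :=
  Algebra.GrothendieckAddGroup.lift (Algebra.GrothendieckAddGroup.of.comp (Vect.map f))

theorem KR0.map_of (f : EquivariantMap τ₁ τ₂) (E : InvBundle.{u₂, w} τ₂) :
    KR0.map f (KR0.of E) = KR0.of (E.pullback f) :=
  DFunLike.congr_fun (Algebra.GrothendieckAddGroup.lift.symm_apply_apply
    (Algebra.GrothendieckAddGroup.of.comp (Vect.map f))) (Vect.mk E)

theorem KR0.map_comp (g : EquivariantMap τ₂ τ₃) (f : EquivariantMap τ₁ τ₂) :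
    KR0.map.{u₁, u₃, w} (g.comp f) = (KR0.map f).comp (KR0.map g) := by
  refine grothHom_ext fun m => ?_
  obtain ⟨E⟩ := m
  change KR0.map _ (KR0.of E) = KR0.map f (KR0.map g (KR0.of E))
  rw [KR0.map_of, KR0.map_of, KR0.map_of]
  exact congrArg Algebra.GrothendieckAddGroup.of (Vect.mk_eq.2 (E.pullback_comp g f))

end Pullback

/-! ## Function algebras and range bundles -/

section FunctionAlgebra

variable {X : Type u} [TopologicalSpace X]

/-- The real C*-algebra `A(X, τ) = {f ∈ C(X, ℂ) | f(τ x) = conj (f x)}`. -/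
def invFunctions (τ : TopInvolution X) : StarSubalgebra ℝ C(X, ℂ) where
  carrier := {f | ∀ x, f (τ x) = starRingEnd ℂ (f x)}
  mul_mem' := fun {f g} hf hg x => by simp [hf x, hg x]
  one_mem' := fun x => by simp
  add_mem' := fun {f g} hf hg x => by simp [hf x, hg x]
  zero_mem' := fun x => by simp
  algebraMap_mem' := fun r x => by simp
  star_mem' := fun {f} hf x => by simp [hf x]

/-- The homomorphism `f^* : A(X₂, τ₂) → A(X₁, τ₁)`, `g ↦ g ∘ f`. -/
def invFunctionsMap {X₁ : Type u₁} {X₂ : Type u₂} [TopologicalSpace X₁] [TopologicalSpace X₂]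
    {τ₁ : TopInvolution X₁} {τ₂ : TopInvolution X₂} (f : EquivariantMap τ₁ τ₂) :
    invFunctions τ₂ →⋆ₐ[ℝ] invFunctions τ₁ where
  toFun g := ⟨g.1.comp ⟨f, f.continuous_toFun⟩, fun x => by
    change g.1 (f (τ₁ x)) = starRingEnd ℂ (g.1 (f x))
    rw [f.map_involution]
    exact g.2 (f x)⟩
  map_one' := rfl
  map_mul' _ _ := rfl
  map_zero' := rfl
  map_add' _ _ := rfl
  commutes' _ := rfl
  map_star' _ := rfl

variable {τ : TopInvolution X}

/-- The value `p(x) ∈ M_n(ℂ)` of a projection `p ∈ M_n(A(X, τ))`. -/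
def projAt (p : MatProj (invFunctions τ)) (x : X) : Matrix (Fin p.size) (Fin p.size) ℂ :=
  p.mat.map fun a => a.1 x

theorem continuous_projAt (p : MatProj (invFunctions τ)) : Continuous (projAt p) :=
  continuous_matrix fun i j => (p.mat i j).1.continuous

theorem projAt_idem (p : MatProj (invFunctions τ)) (x : X) :
    projAt p x * projAt p x = projAt p x := by
  let ev : invFunctions τ →+* ℂ :=
    { toFun := fun a => a.1 x
      map_one' := rfl
      map_mul' := fun _ _ => rfl
      map_zero' := rfl
      map_add' := fun _ _ => rfl }
  have h : (p.mat * p.mat).map ev = p.mat.map ev * p.mat.map ev := Matrix.map_mul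
  rw [p.idem] at h
  exact h.symm

theorem projAt_involution (p : MatProj (invFunctions τ)) (x : X) :
    projAt p (τ x) = (projAt p x).map (starRingEnd ℂ) := by
  ext i j
  exact (p.mat i j).2 x

/-- The range `{v | M v = v}` of an idempotent matrix. -/
def fixedSpace {n : ℕ} (M : Matrix (Fin n) (Fin n) ℂ) : Submodule ℂ (Fin n → ℂ) where
  carrier := {v | M.mulVec v = v}
  add_mem' := fun {v w} hv hw => by
    change M.mulVec (v + w) = v + w
    rw [Matrix.mulVec_add, hv, hw]
  zero_mem' := Matrix.mulVec_zero M
  smul_mem' := fun c v hv => by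
    change M.mulVec (c • v) = c • v
    rw [Matrix.mulVec_smul, hv]

/-- The fibre of the range bundle: `(E_p)_x = {v ∈ ℂⁿ | p(x) v = v}` (lifted to the universe in
which fibres live). -/
abbrev RangeFiber (p : MatProj (invFunctions τ)) (x : X) : Type w :=
  ULift.{w} (fixedSpace (projAt p x))

/-- The inclusion `E_p ⊆ X × ℂⁿ`. -/
def rangeToProd (p : MatProj (invFunctions τ)) (e : Total (RangeFiber.{u, w} p)) :
    X × (Fin p.size → ℂ) :=
  (e.base, e.vec.down)

/-- The topology of `E_p` as a subspace of `X × ℂⁿ`. -/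
instance rangeTopology (p : MatProj (invFunctions τ)) :
    TopologicalSpace (Total (RangeFiber.{u, w} p)) :=
  TopologicalSpace.induced (rangeToProd p) inferInstance

theorem continuous_rangeToProd (p : MatProj (invFunctions τ)) :
    Continuous (rangeToProd.{u, w} p) := continuous_induced_dom

theorem isLocallyTrivial_range (p : MatProj (invFunctions τ)) :
    IsLocallyTrivial (RangeFiber.{u, w} p) := by
  intro x₀
  let P := projAt p
  have hP : ∀ x, P x * P x = P x := projAt_idem p
  let g : X → Matrix (Fin p.size) (Fin p.size) ℂ :=
    fun x => P x₀ * P x + (1 - P x₀) * (1 - P x)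
  have hgc : Continuous g := by
    have := continuous_projAt p
    fun_prop
  have hg0 : g x₀ = 1 := by
    simp only [g, mul_sub, sub_mul, hP, mul_one, one_mul]
    abel
  have hgP : ∀ x, g x * P x = P x₀ * g x := fun x => by
    simp only [g, mul_sub, sub_mul, mul_add, add_mul, mul_one, one_mul, mul_assoc, hP]
    simp only [← mul_assoc, hP]
    abel
  let U : Set X := {x | (g x).det ≠ 0}
  have hdet : Continuous fun x => (g x).det := hgc.matrix_det
  have hU : IsOpen U := isOpen_ne_fun hdet continuous_const
  have hu : ∀ x : U, IsUnit (g x).det := fun x => isUnit_iff_ne_zero.2 x.2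
  have hinv : ∀ x : U, (g x)⁻¹ * P x₀ = P x * (g x)⁻¹ := fun x => by
    have h1 := Matrix.nonsing_inv_mul (g x) (hu x)
    have h2 := Matrix.mul_nonsing_inv (g x) (hu x)
    calc (g x)⁻¹ * P x₀ = (g x)⁻¹ * (P x₀ * g x) * (g x)⁻¹ := by
          rw [mul_assoc, mul_assoc, h2, mul_one]
      _ = _ := by rw [← hgP, ← mul_assoc, h1, one_mul]
  have hinvc : Continuous fun x : U => (g x)⁻¹ := by
    have : (fun x : U => (g x)⁻¹) = fun x : U => ((g x).det)⁻¹ • (g x).adjugate := by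
      funext x
      rw [Matrix.inv_def, Ring.inverse_eq_inv']
    rw [this]
    exact ((hdet.comp continuous_subtype_val).inv₀ fun x => x.2).smul
      ((hgc.comp continuous_subtype_val).matrix_adjugate)
  let ψ : fixedSpace (P x₀) ≃ₗ[ℂ] (Fin (Module.finrank ℂ (fixedSpace (P x₀))) → ℂ) :=
    (Module.finBasis ℂ (fixedSpace (P x₀))).equivFun
  have hψ : Continuous ψ := ψ.toLinearMap.continuous_of_finiteDimensional
  have hψ' : Continuous ψ.symm := ψ.symm.toLinearMap.continuous_of_finiteDimensional
  let φ : ∀ x : U, RangeFiber.{u, w} p x.1 ≃ₗ[ℂ] fixedSpace (P x₀) := fun x =>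
    { toFun := fun v => ⟨(g x).mulVec v.down.1, by
        change (P x₀).mulVec ((g x).mulVec v.down.1) = _
        have hv : (P x).mulVec v.down.1 = v.down.1 := v.down.2
        rw [Matrix.mulVec_mulVec, ← hgP, ← Matrix.mulVec_mulVec, hv]⟩
      map_add' := fun v v' => Subtype.ext (Matrix.mulVec_add (g x) v.down.1 v'.down.1)
      map_smul' := fun c v => Subtype.ext (Matrix.mulVec_smul (g x) c v.down.1)
      invFun := fun v => ⟨⟨((g x)⁻¹).mulVec v.1, by
        change (P x).mulVec (((g x)⁻¹).mulVec v.1) = _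
        have hv : (P x₀).mulVec v.1 = v.1 := v.2
        rw [Matrix.mulVec_mulVec, ← hinv, ← Matrix.mulVec_mulVec, hv]⟩⟩
      left_inv := fun v => by
        refine ULift.ext _ _ (Subtype.ext ?_)
        change ((g x)⁻¹).mulVec ((g x).mulVec v.down.1) = v.down.1
        rw [Matrix.mulVec_mulVec, Matrix.nonsing_inv_mul _ (hu x), Matrix.one_mulVec]
      right_inv := fun v => by
        refine Subtype.ext ?_
        change (g x).mulVec (((g x)⁻¹).mulVec v.1) = v.1
        rw [Matrix.mulVec_mulVec, Matrix.mul_nonsing_inv _ (hu x), Matrix.one_mulVec] }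
  refine ⟨U, _, fun x => (φ x).trans ψ, hU, ?_, ?_, ?_⟩
  · change (g x₀).det ≠ 0
    rw [hg0, Matrix.det_one]
    exact one_ne_zero
  · refine hψ.comp (Continuous.subtype_mk ?_ _)
    have hc := (continuous_rangeToProd.{u, w} p).comp
      (continuous_subtype_val : Continuous (fun e : {e : Total (RangeFiber.{u, w} p) //
        e.base ∈ U} => e.1))
    exact (hgc.comp (continuous_fst.comp hc)).matrix_mulVec (continuous_snd.comp hc)
  · refine continuous_induced_rng.2 (Continuous.prodMk
      (continuous_subtype_val.comp continuous_fst) ?_)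
    exact (hinvc.comp continuous_fst).matrix_mulVec
      (continuous_subtype_val.comp (hψ'.comp continuous_snd))

/-- The range bundle `E_p = {(x, v) ∈ X × ℂⁿ | p(x) v = v}` of a projection `p ∈ M_n(A(X, τ))`,
with the involution `(x, v) ↦ (τ x, conj v)`. -/
def rangeBundle (p : MatProj (invFunctions τ)) : InvBundle.{u, w} τ where
  fiber := RangeFiber p
  continuous_base := continuous_fst.comp (continuous_rangeToProd p)
  isLocallyTrivial := isLocallyTrivial_range p
  conj {x y} h :=
    { toFun := fun v => ⟨⟨fun i => starRingEnd ℂ (v.down.1 i), by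
        have hv : (projAt p x).mulVec v.down.1 = v.down.1 := v.down.2
        change (projAt p y).mulVec _ = _
        rw [h, projAt_involution]
        funext i
        have := congrArg (starRingEnd ℂ) (congrFun hv i)
        simpa [Matrix.mulVec, dotProduct, map_sum] using this⟩⟩
      map_add' := fun v v' => ULift.ext _ _ (Subtype.ext (funext fun i => map_add _ _ _))
      map_smul' := fun c v => ULift.ext _ _ (Subtype.ext (funext fun i => map_mul _ _ _)) }
  conj_conj {x y} h h' v :=
    ULift.ext _ _ (Subtype.ext (funext fun i => Complex.conj_conj _))
  continuous_conj := by
    have hc := continuous_rangeToProd.{u, w} p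
    refine continuous_induced_rng.2 (Continuous.prodMk
      (τ.continuous_toFun.comp (continuous_fst.comp hc)) ?_)
    exact continuous_pi fun i => Complex.continuous_conj.comp
      ((continuous_apply i).comp (continuous_snd.comp hc))

end FunctionAlgebra

/-! ## Locally compact spaces -/

section LocallyCompact

variable {X : Type u} [TopologicalSpace X]

/-- The involution `τ⁺` of the one-point compactification `X⁺`, with `τ⁺(∞) = ∞`. -/
def TopInvolution.onePoint (τ : TopInvolution X) : TopInvolution (OnePoint X) where
  toFun := OnePoint.map τ
  continuous_toFun :=
    (Homeomorph.onePointCongr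
      { toFun := τ, invFun := τ, left_inv := τ.involutive, right_inv := τ.involutive
        continuous_toFun := τ.continuous_toFun
        continuous_invFun := τ.continuous_toFun } : OnePoint X ≃ₜ OnePoint X).continuous
  involutive x := by
    induction x using OnePoint.rec with
    | infty => rfl
    | coe x => simp [τ.involutive x]

/-- The identity involution of the one-point space. -/
def pointInvolution : TopInvolution Unit where
  toFun := id
  continuous_toFun := continuous_id
  involutive _ := rfl

/-- The inclusion `ι : + → X⁺` of the point at infinity. -/
def inftyMap (τ : TopInvolution X) : EquivariantMap pointInvolution τ.onePoint where
  toFun _ := OnePoint.infty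
  continuous_toFun := continuous_const
  map_involution _ := rfl

/-- `KR⁰(X, τ) = ker (ι^* : KR⁰(X⁺, τ⁺) → KR⁰(+, id))`, for locally compact `X`. -/
def KR0lc (τ : TopInvolution X) : AddSubgroup (KR0.{u, w} τ.onePoint) :=
  (KR0.map.{0, u, w} (inftyMap τ)).ker

/-- The real C*-algebra `{f ∈ C₀(X, ℂ) | f(τ x) = conj (f x)}`. -/
def invFunctionsZero (τ : TopInvolution X) :
    NonUnitalStarSubalgebra ℝ (ZeroAtInftyContinuousMap X ℂ) where
  carrier := {f | ∀ x, f (τ x) = starRingEnd ℂ (f x)}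
  mul_mem' := fun {f g} hf hg x => by simp [hf x, hg x]
  add_mem' := fun {f g} hf hg x => by simp [hf x, hg x]
  zero_mem' := fun x => by simp
  smul_mem' := fun r f hf x => by simp [hf x]
  star_mem' := fun {f} hf x => by simp [hf x]

/-- A proper map of locally compact spaces with involution. -/
structure ProperEquivariantMap {X₁ : Type u₁} {X₂ : Type u₂} [TopologicalSpace X₁]
    [TopologicalSpace X₂] (τ₁ : TopInvolution X₁) (τ₂ : TopInvolution X₂) extends
    EquivariantMap τ₁ τ₂ where
  isProperMap : IsProperMap toFun

variable {X₁ : Type u₁} {X₂ : Type u₂} [TopologicalSpace X₁] [TopologicalSpace X₂]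
  {τ₁ : TopInvolution X₁} {τ₂ : TopInvolution X₂}

theorem ProperEquivariantMap.tendsto_coclosedCompact (f : ProperEquivariantMap τ₁ τ₂) :
    Filter.Tendsto f.toFun (Filter.coclosedCompact X₁) (Filter.coclosedCompact X₂) := by
  refine (Filter.hasBasis_coclosedCompact.tendsto_iff Filter.hasBasis_coclosedCompact).2 ?_
  rintro K ⟨hK, hK'⟩
  exact ⟨f.toFun ⁻¹' K, ⟨hK.preimage f.continuous_toFun,
    f.isProperMap.isCompact_preimage hK'⟩, fun x hx => hx⟩

/-- The extension `f⁺ : X₁⁺ → X₂⁺` of a proper map, with `f⁺(∞) = ∞`. -/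
def ProperEquivariantMap.onePoint (f : ProperEquivariantMap τ₁ τ₂) :
    EquivariantMap τ₁.onePoint τ₂.onePoint where
  toFun := OnePoint.map f.toFun
  continuous_toFun := OnePoint.continuous_map f.continuous_toFun f.tendsto_coclosedCompact
  map_involution x := by
    induction x using OnePoint.rec with
    | infty => rfl
    | coe x => exact congrArg OnePoint.some (f.map_involution x)

/-- The homomorphism `KR⁰(X₂, τ₂) → KR⁰(X₁, τ₁)` induced by a proper map `f`: the restriction
of `(f⁺)^*`. -/
def KR0lc.map (f : ProperEquivariantMap τ₁ τ₂) : KR0lc.{u₂, w} τ₂ →+ KR0lc.{u₁, w} τ₁ :=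
  ((KR0.map.{u₁, u₂, w} f.onePoint).comp (KR0lc.{u₂, w} τ₂).subtype).codRestrict
    (KR0lc.{u₁, w} τ₁) fun z => by
      have h : f.onePoint.comp (inftyMap τ₁) = inftyMap τ₂ := rfl
      have hz : KR0.map (inftyMap τ₂) (z : KR0.{u₂, w} τ₂.onePoint) = 0 := z.2
      change KR0.map (inftyMap τ₁) (KR0.map f.onePoint (z : KR0.{u₂, w} τ₂.onePoint)) = 0
      rw [← AddMonoidHom.comp_apply, ← KR0.map_comp, h, hz]

/-- The homomorphism `f^* : C₀(X₂, τ₂) → C₀(X₁, τ₁)`, `g ↦ g ∘ f`, for a proper map `f`. -/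
def invFunctionsZeroMap [T2Space X₂] (f : ProperEquivariantMap τ₁ τ₂) :
    invFunctionsZero τ₂ →⋆ₙₐ[ℝ] invFunctionsZero τ₁ where
  toFun g := ⟨⟨⟨fun x => g.1 (f.toFun x), g.1.continuous.comp f.continuous_toFun⟩,
    (zero_at_infty g.1).comp (by
      have := f.tendsto_coclosedCompact.mono_left Filter.cocompact_le_coclosedCompact
      rwa [Filter.coclosedCompact_eq_cocompact] at this)⟩, fun x => by
    change g.1 (f.toFun (τ₁ x)) = starRingEnd ℂ (g.1 (f.toFun x))
    rw [f.map_involution]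
    exact g.2 (f.toFun x)⟩
  map_smul' _ _ := rfl
  map_zero' := rfl
  map_add' _ _ := rfl
  map_mul' _ _ := rfl
  map_star' _ := rfl

/-- The extension by zero `C₀(X, τ) → A(X⁺, τ⁺)`. -/
def extendZero [T2Space X] (τ : TopInvolution X) :
    invFunctionsZero τ →⋆ₙₐ[ℝ] invFunctions τ.onePoint where
  toFun f := ⟨OnePoint.continuousMapMk ⟨f.1, f.1.continuous⟩ 0 (by
      rw [Filter.coclosedCompact_eq_cocompact]
      exact zero_at_infty f.1), fun x => by
    induction x using OnePoint.rec with
    | infty => exact (map_zero (starRingEnd ℂ)).symm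
    | coe x => exact f.2 x⟩
  map_smul' r f := Subtype.ext (ContinuousMap.ext fun x => by
    induction x using OnePoint.rec with
    | infty => exact (smul_zero r).symm
    | coe x => rfl)
  map_zero' := Subtype.ext (ContinuousMap.ext fun x => by
    induction x using OnePoint.rec with
    | infty => rfl
    | coe x => rfl)
  map_add' f g := Subtype.ext (ContinuousMap.ext fun x => by
    induction x using OnePoint.rec with
    | infty => exact (add_zero (0 : ℂ)).symm
    | coe x => rfl)
  map_mul' f g := Subtype.ext (ContinuousMap.ext fun x => by
    induction x using OnePoint.rec with
    | infty => exact (mul_zero (0 : ℂ)).symm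
    | coe x => rfl)
  map_star' f := Subtype.ext (ContinuousMap.ext fun x => by
    induction x using OnePoint.rec with
    | infty => exact (star_zero ℂ).symm
    | coe x => rfl)

/-- The canonical identification `C₀(X, τ)⁺ → A(X⁺, τ⁺)`: the pair `(f, r)` is sent to the
function with value `f(x) + r` at `x ∈ X` and `r` at `∞`. -/
def unitizationToOnePoint [T2Space X] (τ : TopInvolution X) :
    Unitization ℝ (invFunctionsZero τ) →⋆ₐ[ℝ] invFunctions τ.onePoint :=
  Unitization.starLift (extendZero τ)

theorem unitizationToOnePoint_coe [T2Space X] (τ : TopInvolution X)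
    (f : Unitization ℝ (invFunctionsZero τ)) (x : X) :
    (unitizationToOnePoint τ f).1 (x : OnePoint X) = f.snd.1 x + f.fst :=
  add_comm _ _

theorem unitizationToOnePoint_infty [T2Space X] (τ : TopInvolution X)
    (f : Unitization ℝ (invFunctionsZero τ)) :
    (unitizationToOnePoint τ f).1 OnePoint.infty = f.fst :=
  add_zero _

end LocallyCompact

end KRTheory
end

/-!
The map `[p] ↦ [E_p]` is already an isomorphism of monoids `𝒫_∞(A(X, τ)) ≅ Vect(X, τ)` for compact
`X` (`rangeHom`), and `Θ` is its Grothendieck completion.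

*Injectivity.* An isomorphism `E_p ≅ E_q`, extended by zero on the complements of the ranges, is a
matrix `T` over `A(X, τ)` with a relative inverse `T'`, so that `T' T = p` and `T T' = q`. Such a
similarity is improved to a partial isometry by polar decomposition,
`S = T (T* T + 1 - p) ^ (-1/2)`. The inverse square root is taken pointwise by the functional
calculus of complex matrices; the result is again a matrix over `A(X, τ)`, because the functional
calculus is continuous in the matrix and commutes with complex conjugation
(`exists_inverse_sqrt`, `HasInverseSqrt.partialIsomEquiv`).

*Surjectivity.* A partition of unity makes a bundle `E` a retract of a trivial bundle, with an
inclusion `J` and a projection `K`, at first without regard to the involutions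
(`InvBundle.exists_linear_retraction`). Replacing `J` by its real and imaginary
parts (up to scalars) for the real structure `J ↦ conj ∘ J ∘ σ` gives an equivariant retraction
(`InvBundle.equivariantRetraction`). Then `J K` is an idempotent matrix over `A(X, τ)` with range
`E`, and the orthogonal projection `p` onto its range is again a matrix over `A(X, τ)`
(`HasInverseSqrt.exists_projection`), so `E ≅ E_p`.

Additivity and naturality compare range bundles with sums and pullbacks, which are retracts of
trivial bundles whose idempotents can be read off (`Retraction.iso_of_idem_eq`).

For locally compact `X`, the homomorphism `A₀(X, τ)⁺ → A(X⁺, τ⁺)` is bijective, and by naturality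
of `Θ` for the inclusion of `∞` it matches the kernels that define the two groups
(`thetaPlus_mem_iff`).
-/

noncomputable section

namespace KRTheory

/-! ### Matrices over the function algebra -/

section FunctionMatrices

variable {X : Type u} [TopologicalSpace X] {τ : TopInvolution X} {ι κ : Type*}

/-- Evaluation at `x` as a `*`-homomorphism `A(X, τ) → ℂ`. -/
def evalHom (τ : TopInvolution X) (x : X) : invFunctions τ →⋆ₐ[ℝ] ℂ where
  toFun a := a.1 x
  map_one' := rfl
  map_mul' _ _ := rfl
  map_zero' := rfl
  map_add' _ _ := rfl
  commutes' _ := rfl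
  map_star' _ := rfl

/-- The value `M(x)` of a matrix `M` over `A(X, τ)`. -/
def matAt (M : Matrix ι κ (invFunctions τ)) (x : X) : Matrix ι κ ℂ := M.map (evalHom τ x)

theorem matAt_mul {μ : Type*} [Fintype κ] (M : Matrix ι κ (invFunctions τ))
    (N : Matrix κ μ (invFunctions τ)) (x : X) : matAt (M * N) x = matAt M x * matAt N x :=
  Matrix.map_mul

theorem matAt_one [DecidableEq ι] (x : X) :
    matAt (1 : Matrix ι ι (invFunctions τ)) x = 1 :=
  Matrix.map_one _ (map_zero _) (map_one _)

theorem matAt_conjTranspose (M : Matrix ι κ (invFunctions τ)) (x : X) :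
    matAt Mᴴ x = (matAt M x)ᴴ := rfl

theorem continuous_matAt (M : Matrix ι κ (invFunctions τ)) : Continuous (matAt M) :=
  continuous_matrix fun i j => (M i j).1.continuous

theorem matAt_involution (M : Matrix ι κ (invFunctions τ)) (x : X) :
    matAt M (τ x) = (matAt M x).map (starRingEnd ℂ) := by
  ext i j
  exact (M i j).2 x

theorem matrix_ext_matAt {M N : Matrix ι κ (invFunctions τ)}
    (h : ∀ x, matAt M x = matAt N x) : M = N := by
  ext i j x
  exact congrFun (congrFun (h x) i) j

/-- The matrix over `A(X, τ)` given by a continuous equivariant family of complex matrices. -/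
def ofFamily (M : X → Matrix ι κ ℂ) (hM : Continuous M)
    (hτ : ∀ x, M (τ x) = (M x).map (starRingEnd ℂ)) : Matrix ι κ (invFunctions τ) :=
  fun i j => ⟨⟨fun x => M x i j, hM.matrix_elem i j⟩, fun x => congrFun (congrFun (hτ x) i) j⟩

theorem matAt_ofFamily (M : X → Matrix ι κ ℂ) (hM : Continuous M)
    (hτ : ∀ x, M (τ x) = (M x).map (starRingEnd ℂ)) (x : X) :
    matAt (ofFamily M hM hτ) x = M x := rfl

end FunctionMatrices

/-! ### Inverse square roots and polar decomposition -/

section InverseSqrt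

variable {X : Type u} [TopologicalSpace X] {τ : TopInvolution X} {ι κ : Type*} [Fintype ι]
  [DecidableEq ι] [Fintype κ]

/-- Entrywise complex conjugation of matrices, as a homomorphism of real `*`-algebras. -/
def conjHom (ι : Type*) [Fintype ι] [DecidableEq ι] :
    Matrix ι ι ℂ →⋆ₐ[ℝ] Matrix ι ι ℂ :=
  { Complex.conjAe.toAlgHom.mapMatrix with
    map_star' := fun M => by
      ext i j
      simp [Matrix.star_apply] }

theorem conjHom_apply (M : Matrix ι ι ℂ) : conjHom ι M = M.map (starRingEnd ℂ) := rfl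

open scoped MatrixOrder ComplexOrder Matrix.Norms.L2Operator in
/-- The functional calculus for `t ↦ t ^ (-1/2)` can be applied pointwise to a positive definite
matrix over `A(X, τ)`: it is continuous in the matrix and commutes with complex conjugation. -/
theorem exists_inverse_sqrt (h : Matrix ι ι (invFunctions τ))
    (hpos : ∀ x, (matAt h x).PosDef) :
    ∃ r : Matrix ι ι (invFunctions τ), rᴴ = r ∧ r * h * r = 1 ∧
      ∀ p, h * p = p * h → r * p = p * r := by
  let f : ℝ → ℝ := fun t => (Real.sqrt t)⁻¹
  have hf : ContinuousOn f (Set.Ioi 0) :=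
    Real.continuous_sqrt.continuousOn.inv₀ fun t ht => (Real.sqrt_pos.2 ht).ne'
  have hsp : ∀ x, spectrum ℝ (matAt h x) ⊆ Set.Ioi 0 := fun x t ht =>
    (Matrix.isStrictlyPositive_iff_posDef.2 (hpos x)).spectrum_pos ht
  have hsa : ∀ x, IsSelfAdjoint (matAt h x) := fun x => (hpos x).isHermitian
  have hcont : Continuous fun x => cfc f (matAt h x) := by
    refine Continuous.cfc_of_mem_nhdsSet (s := Set.Ioi 0) f ?_ (continuous_matAt h) hsa hf
    exact isOpen_Ioi.mem_nhdsSet.2 (Set.iUnion_subset hsp)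
  have hconj : ∀ x, cfc f (matAt h (τ x)) = (cfc f (matAt h x)).map (starRingEnd ℂ) := by
    intro x
    have hc : Continuous (conjHom ι) := by
      change Continuous fun M : Matrix ι ι ℂ => M.map (starRingEnd ℂ)
      exact continuous_id.matrix_map Complex.continuous_conj
    have hx : conjHom ι (matAt h x) = matAt h (τ x) := (matAt_involution h x).symm
    have := (conjHom ι).map_cfc f (matAt h x) (hf.mono (hsp x)) hc (hsa x) (hx ▸ hsa (τ x))
    rw [← conjHom_apply, this, hx]
  refine ⟨ofFamily _ hcont hconj, ?_, ?_, ?_⟩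
  · refine matrix_ext_matAt fun x => ?_
    rw [matAt_conjTranspose, matAt_ofFamily]
    exact cfc_predicate f (matAt h x)
  · refine matrix_ext_matAt fun x => ?_
    have hfx := hf.mono (hsp x)
    rw [matAt_mul, matAt_mul, matAt_ofFamily, matAt_one]
    conv_lhs => enter [1, 2]; rw [← cfc_id ℝ (matAt h x) (hsa x)]
    have hfx' : ContinuousOn (fun t => f t * id t) (spectrum ℝ (matAt h x)) :=
      hfx.mul continuousOn_id
    rw [← cfc_mul f id _ hfx continuousOn_id, ← cfc_mul _ f _ hfx' hfx,
      ← cfc_one ℝ (matAt h x) (hsa x)]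
    refine cfc_congr fun t ht => ?_
    have h1 : Real.sqrt t ≠ 0 := (Real.sqrt_pos.2 (hsp x ht)).ne'
    have h2 : Real.sqrt t * Real.sqrt t = t := Real.mul_self_sqrt (le_of_lt (hsp x ht))
    simp only [f, id, Pi.one_apply]
    field_simp
    rw [pow_two, h2]
  · intro p hp
    refine matrix_ext_matAt fun x => ?_
    have hx : Commute (matAt h x) (matAt p x) := by
      rw [commute_iff_eq, ← matAt_mul, hp, matAt_mul]
    rw [matAt_mul, matAt_mul, matAt_ofFamily]
    exact (hsa x).commute_cfc hx f

open scoped ComplexOrder in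
/-- If `B` has a left inverse, then `B(x)` is injective for every `x`, so `B* B` is pointwise
positive definite. -/
theorem exists_inverse_sqrt_of_leftInverse (B : Matrix κ ι (invFunctions τ))
    (L : Matrix ι κ (invFunctions τ)) (hLB : L * B = 1) :
    ∃ r : Matrix ι ι (invFunctions τ), rᴴ = r ∧ r * (Bᴴ * B) * r = 1 ∧
      ∀ p, Bᴴ * B * p = p * (Bᴴ * B) → r * p = p * r := by
  refine exists_inverse_sqrt _ fun x => ?_
  rw [matAt_mul, matAt_conjTranspose]
  refine Matrix.PosDef.conjTranspose_mul_self _ ?_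
  refine Function.LeftInverse.injective (g := (matAt L x).mulVec) fun v => ?_
  rw [Matrix.mulVec_mulVec, ← matAt_mul, hLB, matAt_one, Matrix.one_mulVec]

end InverseSqrt

section PolarDecomposition

/-- The property of a `*`-ring `A` used for polar decompositions: for every left invertible matrix
`B` over `A`, the matrix `B* B` has a selfadjoint inverse square root which commutes with
everything that commutes with `B* B`. The index types are restricted to `Type`, which suffices for
matrices indexed by `Fin n`. -/
def HasInverseSqrt (A : Type v) [Ring A] [StarRing A] : Prop :=
  ∀ {ι κ : Type} [Fintype ι] [DecidableEq ι] [Fintype κ] (B : Matrix κ ι A) (L : Matrix ι κ A),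
    L * B = 1 → ∃ r : Matrix ι ι A, rᴴ = r ∧ r * (Bᴴ * B) * r = 1 ∧
      ∀ p, Bᴴ * B * p = p * (Bᴴ * B) → r * p = p * r

theorem hasInverseSqrt_invFunctions {X : Type u} [TopologicalSpace X] (τ : TopInvolution X) :
    HasInverseSqrt (invFunctions τ) :=
  fun B L hLB => exists_inverse_sqrt_of_leftInverse B L hLB

variable {A : Type v} [Ring A] [StarRing A] {ι κ : Type} [Fintype ι] [DecidableEq ι] [Fintype κ]

/-- Projections which are equivalent through mutually inverse maps `T`, `T'` of their ranges are
equivalent through a partial isometry, by polar decomposition: it is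
`T (T* T + 1 - P) ^ (-1/2)`. -/
theorem HasInverseSqrt.partialIsomEquiv (hA : HasInverseSqrt A) {P : Matrix ι ι A}
    {Q : Matrix κ κ A} (hP : IsStarProjection P) (hQ : IsStarProjection Q)
    (T : Matrix κ ι A) (T' : Matrix ι κ A) (h : T' * T = P)
    (h' : T * T' = Q) (hT : T * P = T) : PartialIsomEquiv P Q := by
  obtain ⟨hP1, hP2⟩ := (isStarProjection_iff_matrix P).1 hP
  obtain ⟨hQ1, hQ2⟩ := (isStarProjection_iff_matrix Q).1 hQ
  have hPT : P * Tᴴ = Tᴴ := by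
    have := congrArg Matrix.conjTranspose hT
    rwa [Matrix.conjTranspose_mul, hP2] at this
  have hQT : Q * T = T := by rw [← h', Matrix.mul_assoc, h, hT]
  -- The column `B` of `T` and `1 - P` satisfies `B* B = T* T + 1 - P`.
  obtain ⟨r, r1, r2, r3⟩ := hA (Matrix.fromRows T (1 - P)) (Matrix.fromCols T' 1) (by
    rw [Matrix.fromCols_mul_fromRows, h, Matrix.one_mul, add_sub_cancel])
  have hB : (Matrix.fromRows T (1 - P))ᴴ * Matrix.fromRows T (1 - P) = Tᴴ * T + (1 - P) := by
    rw [Matrix.conjTranspose_fromRows_eq_fromCols_conjTranspose, Matrix.fromCols_mul_fromRows]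
    simp [hP2, mul_sub, sub_mul, hP1]
  rw [hB] at r2 r3
  set H := Tᴴ * T + (1 - P) with hH
  have e1 : H * P = Tᴴ * T := by
    rw [hH, Matrix.add_mul, Matrix.mul_assoc, hT, Matrix.sub_mul, Matrix.one_mul, hP1, sub_self,
      add_zero]
  have e2 : P * H = Tᴴ * T := by
    rw [hH, Matrix.mul_add, ← Matrix.mul_assoc, hPT, Matrix.mul_sub, Matrix.mul_one, hP1, sub_self,
      add_zero]
  have hrP := r3 P (by rw [e1, e2])
  have hrH := r3 H rfl
  have r4 : r * r * H = 1 := by rw [Matrix.mul_assoc, hrH, ← Matrix.mul_assoc, r2]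
  -- Since `S S*` is selfadjoint, `S S* Q = Q` and `Q S S* = S S*` force `S S* = Q`.
  have hSQ : T * r * (T * r)ᴴ * Q = Q := by
    calc T * r * (T * r)ᴴ * Q = T * (r * r) * (Tᴴ * T) * T' := by
          rw [← h', Matrix.conjTranspose_mul, r1]; simp only [Matrix.mul_assoc]
      _ = T * (r * r * H) * P * T' := by
          rw [← e1]; simp only [Matrix.mul_assoc]
      _ = Q := by rw [r4, Matrix.mul_one, hT, h']
  have hQS : Q * (T * r * (T * r)ᴴ) = T * r * (T * r)ᴴ := by
    rw [← Matrix.mul_assoc, ← Matrix.mul_assoc, hQT]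
  refine ⟨T * r, ?_, ?_⟩
  · calc (T * r)ᴴ * (T * r) = r * (Tᴴ * T) * r := by
          rw [Matrix.conjTranspose_mul, r1]; simp only [Matrix.mul_assoc]
      _ = P * (r * H * r) := by
          rw [← e2]; simp only [← Matrix.mul_assoc]; rw [hrP]
      _ = P := by rw [r2, Matrix.mul_one]
  · rw [← hQS]
    have := congrArg Matrix.conjTranspose hSQ
    rwa [Matrix.conjTranspose_mul, Matrix.conjTranspose_mul, Matrix.conjTranspose_conjTranspose,
      hQ2] at this

/-- The orthogonal projection onto the range of an idempotent `e` is `e h⁻¹ e*`, with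
`h = e* e + (1 - e)* (1 - e)`. -/
theorem HasInverseSqrt.exists_projection (hA : HasInverseSqrt A) (e : Matrix ι ι A)
    (he : e * e = e) : ∃ p : Matrix ι ι A, IsStarProjection p ∧ p * e = e ∧ e * p = p := by
  obtain ⟨r, r1, r2, r3⟩ := hA (Matrix.fromRows e (1 - e)) (Matrix.fromCols e (1 - e)) (by
    rw [Matrix.fromCols_mul_fromRows]
    simp [mul_sub, sub_mul, he])
  have hB : (Matrix.fromRows e (1 - e))ᴴ * Matrix.fromRows e (1 - e) =
      eᴴ * e + (1 - eᴴ) * (1 - e) := by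
    rw [Matrix.conjTranspose_fromRows_eq_fromCols_conjTranspose, Matrix.fromCols_mul_fromRows]
    simp
  rw [hB] at r2 r3
  set H := eᴴ * e + (1 - eᴴ) * (1 - e) with hH
  have e1 : H * e = eᴴ * e := by
    rw [hH, Matrix.add_mul, Matrix.mul_assoc, Matrix.mul_assoc, he, Matrix.sub_mul 1 e, he,
      Matrix.one_mul, sub_self, Matrix.mul_zero, add_zero]
  have hrH := r3 H rfl
  have r4 : r * r * H = 1 := by rw [Matrix.mul_assoc, hrH, ← Matrix.mul_assoc, r2]
  have hpe : e * (r * r) * eᴴ * e = e := by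
    calc e * (r * r) * eᴴ * e = e * (r * r * H) * e := by
          rw [Matrix.mul_assoc _ eᴴ, ← e1]; simp only [Matrix.mul_assoc]
      _ = e := by rw [r4, Matrix.mul_one, he]
  refine ⟨e * (r * r) * eᴴ, (isStarProjection_iff_matrix _).2 ⟨?_, ?_⟩, hpe, ?_⟩
  · calc e * (r * r) * eᴴ * (e * (r * r) * eᴴ) = e * (r * r) * eᴴ * e * ((r * r) * eᴴ) := by
          simp only [Matrix.mul_assoc]
      _ = e * (r * r) * eᴴ := by rw [hpe]; simp only [Matrix.mul_assoc]
  · simp only [Matrix.conjTranspose_mul, Matrix.conjTranspose_conjTranspose, r1, Matrix.mul_assoc]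
  · simp only [← Matrix.mul_assoc, he]

end PolarDecomposition

/-! ### Range bundles of projections -/

section FamiliesOfMaps

variable {X : Type u} [TopologicalSpace X] {τ : TopInvolution X} {ι κ : Type*} [Fintype ι]

section

variable [DecidableEq ι]

/-- The matrix over `A(X, τ)` given by a continuous equivariant family of linear maps. -/
def ofMaps (L : ∀ _ : X, (ι → ℂ) →ₗ[ℂ] (κ → ℂ)) (hL : ∀ v, Continuous fun x => L x v)
    (hτ : ∀ x v, L (τ x) (star v) = star (L x v)) : Matrix κ ι (invFunctions τ) :=
  ofFamily (fun x => LinearMap.toMatrix' (L x))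
    (continuous_matrix fun i j => by
      simp only [LinearMap.toMatrix'_apply]
      exact (continuous_apply i).comp (hL _))
    (fun x => by
      ext i j
      rw [Matrix.map_apply, LinearMap.toMatrix'_apply, LinearMap.toMatrix'_apply]
      have hj : (Pi.single j 1 : ι → ℂ) = star (Pi.single j 1) := by
        rw [← Pi.single_star, star_one]
      conv_lhs => rw [hj, hτ]
      rfl)

theorem matAt_ofMaps_mulVec (L : ∀ _ : X, (ι → ℂ) →ₗ[ℂ] (κ → ℂ))
    (hL : ∀ v, Continuous fun x => L x v) (hτ : ∀ x v, L (τ x) (star v) = star (L x v))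
    (x : X) (v : ι → ℂ) : (matAt (ofMaps L hL hτ) x).mulVec v = L x v := by
  rw [ofMaps, matAt_ofFamily, LinearMap.toMatrix'_mulVec]

theorem matrix_ext_mulVec {M N : Matrix κ ι (invFunctions τ)}
    (h : ∀ x v, (matAt M x).mulVec v = (matAt N x).mulVec v) : M = N :=
  matrix_ext_matAt fun x => Matrix.ext_of_mulVec_single fun _ => h x _

end

theorem matAt_mul_mulVec [Fintype κ] {μ : Type*} (M : Matrix μ κ (invFunctions τ))
    (N : Matrix κ ι (invFunctions τ)) (x : X) (v : ι → ℂ) :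
    (matAt (M * N) x).mulVec v = (matAt M x).mulVec ((matAt N x).mulVec v) := by
  rw [matAt_mul, Matrix.mulVec_mulVec]

theorem matAt_mulVec_star (M : Matrix κ ι (invFunctions τ)) (x : X) (v : ι → ℂ) :
    (matAt M (τ x)).mulVec (star v) = star ((matAt M x).mulVec v) := by
  ext i
  simp [matAt_involution, Matrix.mulVec, dotProduct]

end FamiliesOfMaps

section RangeBundle

variable {X : Type u} [TopologicalSpace X] {τ : TopInvolution X}

/-- Matrices `S`, `S'` over `A(X, τ)` which are inverse to each other between the ranges of `p`
and `q` give an isomorphism `E_p ≅ E_q`. -/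
theorem rangeBundle_iso {p q : MatProj (invFunctions τ)}
    (S : Matrix (Fin q.size) (Fin p.size) (invFunctions τ))
    (S' : Matrix (Fin p.size) (Fin q.size) (invFunctions τ)) (h : S' * S = p.mat)
    (h' : S * S' = q.mat) (hS : q.mat * S = S) (hS' : p.mat * S' = S') :
    Nonempty (InvBundle.Iso (rangeBundle.{u, w} p) (rangeBundle.{u, w} q)) :=
  ⟨{ equiv := fun x =>
      { toFun := fun v => ⟨⟨(matAt S x).mulVec v.down.1, by
          change (matAt q.mat x).mulVec _ = _
          rw [← matAt_mul_mulVec, hS]⟩⟩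
        map_add' := fun v v' => ULift.ext _ _ (Subtype.ext
          (Matrix.mulVec_add (matAt S x) v.down.1 v'.down.1))
        map_smul' := fun c v => ULift.ext _ _ (Subtype.ext
          (Matrix.mulVec_smul (matAt S x) c v.down.1))
        invFun := fun v => ⟨⟨(matAt S' x).mulVec v.down.1, by
          change (matAt p.mat x).mulVec _ = _
          rw [← matAt_mul_mulVec, hS']⟩⟩
        left_inv := fun v => ULift.ext _ _ (Subtype.ext (by
          change (matAt S' x).mulVec ((matAt S x).mulVec v.down.1) = v.down.1
          rw [← matAt_mul_mulVec, h]
          exact v.down.2))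
        right_inv := fun v => ULift.ext _ _ (Subtype.ext (by
          change (matAt S x).mulVec ((matAt S' x).mulVec v.down.1) = v.down.1
          rw [← matAt_mul_mulVec, h']
          exact v.down.2)) }
     continuous_to := by
      have hc := continuous_rangeToProd.{u, w} p
      exact continuous_induced_rng.2 ((continuous_fst.comp hc).prodMk
        (((continuous_matAt S).comp (continuous_fst.comp hc)).matrix_mulVec
          (continuous_snd.comp hc)))
     continuous_inv := by
      have hc := continuous_rangeToProd.{u, w} q
      exact continuous_induced_rng.2 ((continuous_fst.comp hc).prodMk
        (((continuous_matAt S').comp (continuous_fst.comp hc)).matrix_mulVec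
          (continuous_snd.comp hc)))
     map_conj := by
      rintro x y rfl v
      exact ULift.ext _ _ (Subtype.ext (matAt_mulVec_star S x v.down.1)) }⟩

theorem rangeBundle_iso_of_partialIsomEquiv {p q : MatProj (invFunctions τ)}
    (h : PartialIsomEquiv p.mat q.mat) :
    Nonempty (InvBundle.Iso (rangeBundle.{u, w} p) (rangeBundle.{u, w} q)) := by
  obtain ⟨S, h1, h2, h3, h4⟩ := h.exists_mul p.idem q.idem
  refine rangeBundle_iso S Sᴴ h1 h2 h4 ?_
  have := congrArg Matrix.conjTranspose h3
  rwa [Matrix.conjTranspose_mul, ((isStarProjection_iff_matrix _).1 p.isStarProjection).2] at this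

/-- The projection `ℂⁿ → (E_p)_x`. -/
def toRange (p : MatProj (invFunctions τ)) (x : X) :
    (Fin p.size → ℂ) →ₗ[ℂ] (rangeBundle.{u, w} p).fiber x where
  toFun v := ⟨⟨(projAt p x).mulVec v, by
    change (projAt p x).mulVec ((projAt p x).mulVec v) = _
    rw [Matrix.mulVec_mulVec, projAt_idem]⟩⟩
  map_add' v v' := ULift.ext _ _ (Subtype.ext (Matrix.mulVec_add (projAt p x) v v'))
  map_smul' c v := ULift.ext _ _ (Subtype.ext (Matrix.mulVec_smul (projAt p x) c v))

/-- The inclusion `(E_p)_x → ℂⁿ`. -/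
def ofRange (p : MatProj (invFunctions τ)) (x : X) :
    (rangeBundle.{u, w} p).fiber x →ₗ[ℂ] (Fin p.size → ℂ) where
  toFun v := v.down.1
  map_add' _ _ := rfl
  map_smul' _ _ := rfl

theorem toRange_ofRange (p : MatProj (invFunctions τ)) (x : X)
    (v : (rangeBundle.{u, w} p).fiber x) : toRange p x (ofRange p x v) = v :=
  ULift.ext _ _ (Subtype.ext v.down.2)

theorem continuous_toRange (p : MatProj (invFunctions τ)) :
    Continuous fun z : X × (Fin p.size → ℂ) =>
      (⟨z.1, toRange.{u, w} p z.1 z.2⟩ : Total (rangeBundle.{u, w} p).fiber) :=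
  continuous_induced_rng.2 (continuous_fst.prodMk
    (((continuous_projAt p).comp continuous_fst).matrix_mulVec continuous_snd))

theorem continuous_ofRange (p : MatProj (invFunctions τ)) :
    Continuous fun e : Total (rangeBundle.{u, w} p).fiber => ofRange p e.base e.vec :=
  continuous_snd.comp (continuous_rangeToProd.{u, w} p)

theorem toRange_star (p : MatProj (invFunctions τ)) (x : X) (v : Fin p.size → ℂ) :
    toRange.{u, w} p (τ x) (star v) = (rangeBundle.{u, w} p).conj rfl (toRange p x v) :=
  ULift.ext _ _ (Subtype.ext (matAt_mulVec_star p.mat x v))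

theorem ofRange_conj (p : MatProj (invFunctions τ)) (x : X)
    (v : (rangeBundle.{u, w} p).fiber x) :
    ofRange p (τ x) ((rangeBundle.{u, w} p).conj rfl v) = star (ofRange p x v) := rfl

/-- The matrix over `A(X, τ)` of `ℂⁿ → E_p ≅ E_q ⊆ ℂᵐ`. -/
def isoMatrix {p q : MatProj (invFunctions τ)}
    (i : InvBundle.Iso (rangeBundle.{u, w} p) (rangeBundle.{u, w} q)) :
    Matrix (Fin q.size) (Fin p.size) (invFunctions τ) :=
  ofMaps (fun x => ofRange q x ∘ₗ (i.equiv x).toLinearMap ∘ₗ toRange p x)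
    (fun v => (continuous_ofRange q).comp (i.continuous_to.comp
      ((continuous_toRange p).comp (continuous_id.prodMk continuous_const))))
    (fun x v => by
      simp only [LinearMap.comp_apply, LinearEquiv.coe_coe]
      rw [toRange_star, i.map_conj, ofRange_conj])

theorem isoMatrix_mulVec {p q : MatProj (invFunctions τ)}
    (i : InvBundle.Iso (rangeBundle.{u, w} p) (rangeBundle.{u, w} q)) (x : X)
    (v : Fin p.size → ℂ) :
    (matAt (isoMatrix i) x).mulVec v = ofRange q x (i.equiv x (toRange p x v)) :=
  matAt_ofMaps_mulVec _ _ _ _ _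

/-- The inverse of an isomorphism of bundles with involution. -/
def InvBundle.Iso.symm {E E' : InvBundle.{u, w} τ} (i : InvBundle.Iso E E') :
    InvBundle.Iso E' E where
  equiv x := (i.equiv x).symm
  continuous_to := i.continuous_inv
  continuous_inv := i.continuous_to
  map_conj h v := by
    rw [LinearEquiv.symm_apply_eq, i.map_conj, LinearEquiv.apply_symm_apply]

theorem isoMatrix_symm_mul {p q : MatProj (invFunctions τ)}
    (i : InvBundle.Iso (rangeBundle.{u, w} p) (rangeBundle.{u, w} q)) :
    isoMatrix i.symm * isoMatrix i = p.mat := by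
  refine matrix_ext_mulVec fun x v => ?_
  rw [matAt_mul_mulVec, isoMatrix_mulVec, isoMatrix_mulVec, toRange_ofRange]
  change ofRange p x ((i.equiv x).symm (i.equiv x (toRange p x v))) = _
  rw [LinearEquiv.symm_apply_apply]
  rfl

/-- Isomorphic range bundles come from equivalent projections. -/
theorem partialIsomEquiv_of_rangeBundle_iso {p q : MatProj (invFunctions τ)}
    (i : InvBundle.Iso (rangeBundle.{u, w} p) (rangeBundle.{u, w} q)) :
    PartialIsomEquiv p.mat q.mat := by
  refine HasInverseSqrt.partialIsomEquiv (hasInverseSqrt_invFunctions τ) p.isStarProjection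
    q.isStarProjection
    (isoMatrix i) (isoMatrix i.symm) (isoMatrix_symm_mul i) (isoMatrix_symm_mul i.symm) ?_
  refine matrix_ext_mulVec fun x v => ?_
  rw [matAt_mul_mulVec, isoMatrix_mulVec, isoMatrix_mulVec]
  have : toRange.{u, w} p x ((matAt p.mat x).mulVec v) = toRange p x v :=
    toRange_ofRange p x (toRange p x v)
  rw [this]

end RangeBundle

/-! ### Retracts of trivial bundles -/

section Retraction

variable {X : Type u} [TopologicalSpace X] {τ : TopInvolution X}

/-- A bundle with involution `E` as a retract of the trivial bundle `X × ℂ^ι` with involution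
`(x, v) ↦ (τ x, conj v)`. -/
structure Retraction (E : InvBundle.{u, w} τ) (ι : Type*) where
  incl : ∀ x, E.fiber x →ₗ[ℂ] (ι → ℂ)
  proj : ∀ x, (ι → ℂ) →ₗ[ℂ] E.fiber x
  proj_incl : ∀ x v, proj x (incl x v) = v
  continuous_incl : Continuous fun e : Total E.fiber => incl e.base e.vec
  continuous_proj : Continuous fun z : X × (ι → ℂ) => (⟨z.1, proj z.1 z.2⟩ : Total E.fiber)
  incl_conj : ∀ x v, incl (τ x) (E.conj rfl v) = star (incl x v)
  proj_star : ∀ x v, proj (τ x) (star v) = E.conj rfl (proj x v)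

variable {E : InvBundle.{u, w} τ} {ι κ : Type*}

/-- The idempotent matrix over `A(X, τ)` whose value at `x` is `ℂ^ι → E_x → ℂ^ι`. -/
def Retraction.idem [Fintype ι] [DecidableEq ι] (R : Retraction E ι) :
    Matrix ι ι (invFunctions τ) :=
  ofMaps (fun x => R.incl x ∘ₗ R.proj x)
    (fun _ => R.continuous_incl.comp (R.continuous_proj.comp (continuous_id.prodMk
      continuous_const)))
    (fun x v => by
      rw [LinearMap.comp_apply, R.proj_star, R.incl_conj]
      rfl)

theorem Retraction.idem_mulVec [Fintype ι] [DecidableEq ι] (R : Retraction E ι) (x : X)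
    (v : ι → ℂ) : (matAt R.idem x).mulVec v = R.incl x (R.proj x v) :=
  matAt_ofMaps_mulVec _ _ _ _ _

theorem Retraction.idem_mul_idem [Fintype ι] [DecidableEq ι] (R : Retraction E ι) :
    R.idem * R.idem = R.idem :=
  matrix_ext_mulVec fun x v => by
    rw [matAt_mul_mulVec, R.idem_mulVec, R.idem_mulVec, R.proj_incl]

/-- A retraction of `X × ℂⁿ` onto `E` whose idempotent has the same range as the projection `p`
identifies `E` with `E_p`. -/
theorem Retraction.iso {p : MatProj (invFunctions τ)} (R : Retraction E (Fin p.size))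
    (h : R.idem * p.mat = p.mat) (h' : p.mat * R.idem = R.idem) :
    Nonempty (InvBundle.Iso E (rangeBundle.{u, w} p)) :=
  ⟨{ equiv := fun x =>
      { toFun := fun v => ⟨⟨R.incl x v, by
          change (matAt p.mat x).mulVec _ = _
          have hv : (matAt R.idem x).mulVec (R.incl x v) = R.incl x v := by
            rw [R.idem_mulVec, R.proj_incl]
          rw [← hv, ← matAt_mul_mulVec, h']⟩⟩
        map_add' := fun v v' => ULift.ext _ _ (Subtype.ext (map_add (R.incl x) v v'))
        map_smul' := fun c v => ULift.ext _ _ (Subtype.ext (map_smul (R.incl x) c v))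
        invFun := fun v => R.proj x v.down.1
        left_inv := fun v => R.proj_incl x v
        right_inv := fun v => ULift.ext _ _ (Subtype.ext (by
          change R.incl x (R.proj x v.down.1) = v.down.1
          have hv : (matAt p.mat x).mulVec v.down.1 = v.down.1 := v.down.2
          rw [← R.idem_mulVec]
          conv_lhs => rw [← hv]
          rw [← matAt_mul_mulVec, h, hv])) }
     continuous_to := continuous_induced_rng.2 (E.continuous_base.prodMk R.continuous_incl)
     continuous_inv := R.continuous_proj.comp (continuous_rangeToProd.{u, w} p)
     map_conj := by
      rintro x y rfl v
      exact ULift.ext _ _ (Subtype.ext (R.incl_conj x v)) }⟩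

/-- The case where the idempotent is `p` itself. The size of `p` enters through an equation, since
it is often equal to `n` only after unfolding. -/
theorem Retraction.iso_of_idem_eq {n : ℕ} (R : Retraction E (Fin n))
    (p : MatProj (invFunctions τ)) (hn : n = p.size)
    (h : R.idem = p.mat.submatrix (Fin.cast hn) (Fin.cast hn)) :
    Nonempty (InvBundle.Iso E (rangeBundle.{u, w} p)) := by
  subst hn
  change R.idem = p.mat at h
  exact R.iso (by rw [h, p.idem]) (by rw [h, p.idem])

/-- Change of the index set of the ambient trivial bundle. -/
def Retraction.reindex (R : Retraction E ι) (e : κ ≃ ι) : Retraction E κ where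
  incl x := (LinearMap.funLeft ℂ ℂ e) ∘ₗ R.incl x
  proj x := R.proj x ∘ₗ LinearMap.funLeft ℂ ℂ e.symm
  proj_incl x v := by
    have : LinearMap.funLeft ℂ ℂ e.symm (LinearMap.funLeft ℂ ℂ e (R.incl x v)) = R.incl x v := by
      ext i
      simp [LinearMap.funLeft_apply]
    rw [LinearMap.comp_apply, LinearMap.comp_apply, this, R.proj_incl]
  continuous_incl := continuous_pi fun i => (continuous_apply (e i)).comp R.continuous_incl
  continuous_proj := R.continuous_proj.comp (continuous_fst.prodMk (continuous_pi fun i =>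
    (continuous_apply (e.symm i)).comp continuous_snd))
  incl_conj x v := by
    rw [LinearMap.comp_apply, R.incl_conj]
    rfl
  proj_star x v := R.proj_star x _

/-- A retract of a trivial bundle is a range bundle: take the orthogonal projection onto the range
of its idempotent. -/
theorem Retraction.exists_iso_rangeBundle [Finite ι] (R : Retraction E ι) :
    ∃ p : MatProj (invFunctions τ), Nonempty (InvBundle.Iso E (rangeBundle.{u, w} p)) := by
  obtain ⟨n, ⟨e⟩⟩ := Finite.exists_equiv_fin ι
  let R' := R.reindex e.symm
  obtain ⟨p, hp, h1, h2⟩ := HasInverseSqrt.exists_projection (hasInverseSqrt_invFunctions τ)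
    R'.idem R'.idem_mul_idem
  exact ⟨⟨n, p, hp⟩, Retraction.iso (p := ⟨n, p, hp⟩) R' h2 h1⟩

end Retraction

/-! ### The homomorphism from projections to bundles -/

section RangeHom

variable {X : Type u} [TopologicalSpace X] {τ : TopInvolution X}

/-- `E_p` as a retract of `X × ℂⁿ`. -/
def rangeRetraction (p : MatProj (invFunctions τ)) :
    Retraction (rangeBundle.{u, w} p) (Fin p.size) where
  incl := ofRange p
  proj := toRange p
  proj_incl := toRange_ofRange p
  continuous_incl := continuous_ofRange p
  continuous_proj := continuous_toRange p
  incl_conj := ofRange_conj p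
  proj_star := toRange_star p

/-- `E_p ⊕ E_q` as a retract of `X × ℂ^(m + n)`. -/
def sumRetraction (p q : MatProj (invFunctions τ)) :
    Retraction ((rangeBundle.{u, w} p).sum (rangeBundle.{u, w} q)) (Fin p.size ⊕ Fin q.size) where
  incl x :=
    { toFun := fun v => Sum.elim (ofRange p x v.1) (ofRange q x v.2)
      map_add' := fun v v' => by ext (i | i) <;> rfl
      map_smul' := fun c v => by ext (i | i) <;> rfl }
  proj x := LinearMap.prod (toRange p x ∘ₗ LinearMap.funLeft ℂ ℂ Sum.inl)
    (toRange q x ∘ₗ LinearMap.funLeft ℂ ℂ Sum.inr)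
  proj_incl x v := Prod.ext (toRange_ofRange p x v.1) (toRange_ofRange q x v.2)
  continuous_incl := by
    refine continuous_pi fun i => ?_
    obtain i | i := i
    · exact (continuous_apply i).comp ((continuous_ofRange p).comp
        ((rangeBundle p).continuous_sum_fst (rangeBundle q)))
    · exact (continuous_apply i).comp ((continuous_ofRange q).comp
        ((rangeBundle p).continuous_sum_snd (rangeBundle q)))
  continuous_proj := (rangeBundle p).continuous_to_sum (rangeBundle q) _ _ _
    ((continuous_toRange p).comp (continuous_fst.prodMk (continuous_pi fun i =>
      (continuous_apply (Sum.inl i)).comp continuous_snd)))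
    ((continuous_toRange q).comp (continuous_fst.prodMk (continuous_pi fun i =>
      (continuous_apply (Sum.inr i)).comp continuous_snd)))
  incl_conj x v := by ext (i | i) <;> rfl
  proj_star x v := Prod.ext (toRange_star p x _) (toRange_star q x _)

theorem rangeBundle_add (p q : MatProj (invFunctions τ)) :
    Nonempty (InvBundle.Iso ((rangeBundle.{u, w} p).sum (rangeBundle.{u, w} q))
      (rangeBundle.{u, w} (p.add q))) := by
  refine Retraction.iso_of_idem_eq ((sumRetraction.{u, w} p q).reindex finSumFinEquiv.symm)
    (p.add q) rfl ?_
  change _ = blockSum p.mat q.mat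
  refine matrix_ext_mulVec fun x v => ?_
  rw [Retraction.idem_mulVec]
  have h : matAt (blockSum p.mat q.mat) x = blockSum (matAt p.mat x) (matAt q.mat x) :=
    blockSum_map _ _ _ (map_zero _)
  rw [h, blockSum, Matrix.reindex_apply]
  erw [Matrix.submatrix_mulVec_equiv, Matrix.fromBlocks_mulVec]
  simp only [Matrix.zero_mulVec, add_zero, zero_add]
  rfl

/-- The zero bundle as a retract of `X × ℂ⁰`. -/
def zeroRetraction (τ : TopInvolution X) : Retraction (InvBundle.zero.{u, w} τ) (Fin 0) where
  incl _ := 0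
  proj _ := 0
  proj_incl _ _ := rfl
  continuous_incl := continuous_const
  continuous_proj := by
    refine continuous_induced_rng.2 ?_
    exact continuous_fst
  incl_conj _ _ := funext fun i => i.elim0
  proj_star _ _ := rfl

theorem rangeBundle_zero (τ : TopInvolution X) :
    Nonempty (InvBundle.Iso (InvBundle.zero τ) (rangeBundle.{u, w} (MatProj.zero _))) :=
  (zeroRetraction τ).iso_of_idem_eq (MatProj.zero _) rfl (Matrix.ext fun i => i.elim0)

section Pullback

variable {X₁ : Type u₁} {X₂ : Type u₂} [TopologicalSpace X₁] [TopologicalSpace X₂]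
  {τ₁ : TopInvolution X₁} {τ₂ : TopInvolution X₂}

/-- The pullback of a retraction. -/
def Retraction.pullback {E : InvBundle.{u₂, w} τ₂} {ι : Type*} (R : Retraction E ι)
    (f : EquivariantMap τ₁ τ₂) : Retraction (E.pullback f) ι where
  incl x := R.incl (f x)
  proj x := R.proj (f x)
  proj_incl x := R.proj_incl (f x)
  continuous_incl := R.continuous_incl.comp (E.continuous_pullback_snd f)
  continuous_proj := E.continuous_to_pullback f _ _ continuous_fst
    (R.continuous_proj.comp ((f.continuous_toFun.comp continuous_fst).prodMk continuous_snd))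
  incl_conj x v := by
    have key : ∀ (y : X₂) (h : y = τ₂ (f x)),
        R.incl y (E.conj h v) = star (R.incl (f x) v) := by
      rintro y rfl
      exact R.incl_conj _ _
    exact key _ _
  proj_star x v := by
    have key : ∀ (y : X₂) (h : y = τ₂ (f x)),
        R.proj y (star v) = E.conj h (R.proj (f x) v) := by
      rintro y rfl
      exact R.proj_star _ _
    exact key _ _

theorem rangeBundle_map (f : EquivariantMap τ₁ τ₂) (p : MatProj (invFunctions τ₂)) :
    Nonempty (InvBundle.Iso ((rangeBundle.{u₂, w} p).pullback f)
      (rangeBundle.{u₁, w} (p.map (invFunctionsMap f)))) := by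
  refine Retraction.iso_of_idem_eq ((rangeRetraction p).pullback f) _
    (by unfold MatProj.map; rfl) (matrix_ext_mulVec fun x v => ?_)
  rw [Retraction.idem_mulVec]
  unfold MatProj.map
  rfl

end Pullback

/-- The homomorphism `𝒫_∞(A(X, τ)) → Vect(X, τ)`, `[p] ↦ [E_p]`. -/
def rangeHom (τ : TopInvolution X) : ProjClasses (invFunctions τ) →+ Vect.{u, w} τ where
  toFun := Quotient.lift (fun p => Vect.mk (rangeBundle.{u, w} p)) fun p q h =>
    Vect.mk_eq.2 (rangeBundle_iso_of_partialIsomEquiv ((projEquiv_iff p q).1 h))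
  map_zero' := (Vect.mk_eq.2 (rangeBundle_zero τ)).symm
  map_add' := by
    rintro ⟨p⟩ ⟨q⟩
    exact (Vect.mk_eq.2 (rangeBundle_add p q)).symm

theorem rangeHom_injective (τ : TopInvolution X) : Function.Injective (rangeHom.{u, w} τ) := by
  rintro ⟨p⟩ ⟨q⟩ h
  obtain ⟨i⟩ := Vect.mk_eq.1 h
  exact ProjClasses.mk_eq.2 (partialIsomEquiv_of_rangeBundle_iso i)

end RangeHom

/-! ### Every bundle over a compact space is a retract of a trivial bundle -/

theorem continuous_of_local {Z Y : Type*} [TopologicalSpace Z] [TopologicalSpace Y] {f : Z → Y}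
    (h : ∀ z, ∃ V : Set Z, IsOpen V ∧ z ∈ V ∧ Continuous fun y : V => f y) : Continuous f :=
  continuous_iff_continuousAt.2 fun z => by
    obtain ⟨V, hV, hz, hc⟩ := h z
    exact (continuousOn_iff_continuous_domRestrict.2 hc).continuousAt (hV.mem_nhds hz)

section TotalSpace

variable {X : Type u} [TopologicalSpace X] {τ : TopInvolution X} (E : InvBundle.{u, w} τ)

theorem InvBundle.continuous_zeroSection :
    Continuous fun x : X => (⟨x, 0⟩ : Total E.fiber) := by
  refine continuous_of_local fun x₀ => ?_
  obtain ⟨U, k, φ, hU, hx, h1, h2⟩ := E.isLocallyTrivial x₀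
  refine ⟨U, hU, hx, ?_⟩
  convert h2.comp (continuous_id.prodMk (continuous_const (y := (0 : Fin k → ℂ)))) using 2 with x
  simp

variable {Z : Type*} [TopologicalSpace Z]

theorem InvBundle.continuous_add {b : Z → X} {s s' : ∀ z, E.fiber (b z)}
    (h : Continuous fun z => (⟨b z, s z⟩ : Total E.fiber))
    (h' : Continuous fun z => (⟨b z, s' z⟩ : Total E.fiber)) :
    Continuous fun z => (⟨b z, s z + s' z⟩ : Total E.fiber) := by
  have hb : Continuous b := E.continuous_base.comp h
  refine continuous_of_local fun z₀ => ?_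
  obtain ⟨U, k, φ, hU, hx, h1, h2⟩ := E.isLocallyTrivial (b z₀)
  refine ⟨b ⁻¹' U, hU.preimage hb, hx, ?_⟩
  have c := h1.comp ((h.comp continuous_subtype_val).subtype_mk fun z : b ⁻¹' U => z.2)
  have c' := h1.comp ((h'.comp continuous_subtype_val).subtype_mk fun z : b ⁻¹' U => z.2)
  convert h2.comp (((hb.comp continuous_subtype_val).subtype_mk fun z : b ⁻¹' U => z.2).prodMk
    (c.add c')) using 2 with z
  simp

theorem InvBundle.continuous_sum {b : Z → X} (hb : Continuous b) {α : Type*} (S : Finset α)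
    {s : α → ∀ z, E.fiber (b z)}
    (h : ∀ a, Continuous fun z => (⟨b z, s a z⟩ : Total E.fiber)) :
    Continuous fun z => (⟨b z, ∑ a ∈ S, s a z⟩ : Total E.fiber) := by
  classical
  induction S using Finset.induction_on with
  | empty =>
    simp only [Finset.sum_empty]
    exact E.continuous_zeroSection.comp hb
  | insert a S ha ih =>
    simp only [Finset.sum_insert ha]
    exact E.continuous_add (h a) ih

/-- A local trivialization over `U`, multiplied by the square root of a function `ρ` supported
in `U` and extended by zero. The square root enters both maps, so that their composite is
multiplication by `ρ`. -/
theorem InvBundle.exists_cutoff {U : Set X} {k : ℕ} (φ : ∀ x : U, E.fiber x ≃ₗ[ℂ] (Fin k → ℂ))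
    (hU : IsOpen U)
    (h1 : Continuous (fun e : {e : Total E.fiber // e.base ∈ U} => φ ⟨e.1.base, e.2⟩ e.1.vec))
    (h2 : Continuous (fun q : U × (Fin k → ℂ) => (⟨q.1, (φ q.1).symm q.2⟩ : Total E.fiber)))
    (ρ : C(X, ℝ)) (hρ : tsupport ρ ⊆ U) (hρ0 : ∀ x, 0 ≤ ρ x) :
    ∃ (Φ : ∀ x, E.fiber x →ₗ[ℂ] (Fin k → ℂ)) (Ψ : ∀ x, (Fin k → ℂ) →ₗ[ℂ] E.fiber x),
      (Continuous fun e : Total E.fiber => Φ e.base e.vec) ∧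
      (Continuous fun z : X × (Fin k → ℂ) => (⟨z.1, Ψ z.1 z.2⟩ : Total E.fiber)) ∧
      ∀ x v, Ψ x (Φ x v) = (ρ x : ℂ) • v := by
  classical
  let r : X → ℂ := fun x => (Real.sqrt (ρ x) : ℂ)
  have hr : Continuous r := Complex.continuous_ofReal.comp (Real.continuous_sqrt.comp ρ.continuous)
  have hr0 : ∀ x, x ∉ tsupport ρ → r x = 0 := fun x hx => by
    simp [r, image_eq_zero_of_notMem_tsupport hx]
  refine ⟨fun x => if h : x ∈ U then r x • (φ ⟨x, h⟩).toLinearMap else 0,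
    fun x => if h : x ∈ U then r x • (φ ⟨x, h⟩).symm.toLinearMap else 0, ?_, ?_, ?_⟩
  · refine continuous_of_local fun e => ?_
    by_cases he : e.base ∈ U
    · refine ⟨Total.base ⁻¹' U, hU.preimage E.continuous_base, he, ?_⟩
      refine ((hr.comp (E.continuous_base.comp continuous_subtype_val)).smul h1).congr fun e => ?_
      have he : e.1.base ∈ U := e.2
      simp [dif_pos he]
    · refine ⟨Total.base ⁻¹' (tsupport ρ)ᶜ,
        (isClosed_tsupport ρ).isOpen_compl.preimage E.continuous_base, fun h => he (hρ h), ?_⟩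
      convert continuous_const (y := (0 : Fin k → ℂ)) using 2 with e
      beta_reduce
      split_ifs
      · rw [hr0 _ e.2, zero_smul, LinearMap.zero_apply]
      · rfl
  · refine continuous_of_local fun z => ?_
    by_cases hz : z.1 ∈ U
    · refine ⟨Prod.fst ⁻¹' U, hU.preimage continuous_fst, hz, ?_⟩
      convert h2.comp (((continuous_fst.comp continuous_subtype_val).subtype_mk
        fun z : (Prod.fst ⁻¹' U : Set (X × (Fin k → ℂ))) => z.2).prodMk
          ((hr.comp (continuous_fst.comp continuous_subtype_val)).smul
            (continuous_snd.comp continuous_subtype_val))) using 2 with z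
      have hz : z.1.1 ∈ U := z.2
      simp [dif_pos hz]
    · refine ⟨Prod.fst ⁻¹' (tsupport ρ)ᶜ,
        (isClosed_tsupport ρ).isOpen_compl.preimage continuous_fst, fun h => hz (hρ h), ?_⟩
      convert E.continuous_zeroSection.comp (continuous_fst.comp continuous_subtype_val)
        using 2 with z
      have hz : r z.1.1 = 0 := hr0 _ z.2
      simp only [Function.comp_apply]
      congr 1
      split_ifs
      · rw [hz, zero_smul, LinearMap.zero_apply]
      · rfl
  · intro x v
    by_cases hx : x ∈ U
    · have : r x * r x = ρ x := by
        simp only [r, ← Complex.ofReal_mul, Real.mul_self_sqrt (hρ0 x)]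
      simp [dif_pos hx, smul_smul, this]
    · have : ρ x = 0 := image_eq_zero_of_notMem_tsupport fun h => hx (hρ h)
      simp [dif_neg hx, this]

/-- A bundle over a compact Hausdorff space is a retract of a trivial bundle, by a partition of
unity. The involution is disregarded. -/
theorem InvBundle.exists_linear_retraction [CompactSpace X] [T2Space X] :
    ∃ (ι : Type u) (_ : Finite ι) (J : ∀ x, E.fiber x →ₗ[ℂ] (ι → ℂ))
      (K : ∀ x, (ι → ℂ) →ₗ[ℂ] E.fiber x),
      (∀ x v, K x (J x v) = v) ∧
      (Continuous fun e : Total E.fiber => J e.base e.vec) ∧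
      (Continuous fun z : X × (ι → ℂ) => (⟨z.1, K z.1 z.2⟩ : Total E.fiber)) := by
  choose U k φ hU hx h1 h2 using E.isLocallyTrivial
  obtain ⟨t, ht⟩ := isCompact_univ.elim_finite_subcover U hU
    fun x _ => Set.mem_iUnion.2 ⟨x, hx x⟩
  obtain ⟨ρ, hρ⟩ := PartitionOfUnity.exists_isSubordinate isClosed_univ
    (fun i : t => U i) (fun i => hU i) (by
      intro x hx
      obtain ⟨i, hi, hxi⟩ := Set.mem_iUnion₂.1 (ht hx)
      exact Set.mem_iUnion.2 ⟨⟨i, hi⟩, hxi⟩)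
  choose Φ Ψ hΦ hΨ hΨΦ using fun i : t =>
    E.exists_cutoff (φ i) (hU i) (h1 i) (h2 i) (ρ i) (hρ i) (ρ.nonneg i)
  have hsum : ∀ x, ∑ i : t, ((ρ i x : ℝ) : ℂ) = 1 := fun x => by
    rw [← Complex.ofReal_sum, ← finsum_eq_sum_of_fintype, ρ.sum_eq_one (Set.mem_univ x),
      Complex.ofReal_one]
  refine ⟨(Σ i : t, Fin (k i)), inferInstance,
    fun x => LinearMap.pi fun a => LinearMap.proj a.2 ∘ₗ Φ a.1 x,
    fun x => ∑ i : t, (Ψ i x ∘ₗ LinearMap.funLeft ℂ ℂ (Sigma.mk (β := fun i : t => Fin (k i)) i)), ?_, ?_, ?_⟩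
  · intro x v
    rw [LinearMap.sum_apply]
    have h : ∑ i : t, Ψ i x (Φ i x v) = v := by
      simp only [hΨΦ, ← Finset.sum_smul, hsum, one_smul]
    exact h
  · exact continuous_pi fun a => (continuous_apply a.2).comp (hΦ a.1)
  · simp only [LinearMap.sum_apply]
    exact E.continuous_sum continuous_fst _ fun i => (hΨ i).comp (continuous_fst.prodMk
      (continuous_pi fun j => (continuous_apply (⟨i, j⟩ : Σ i : t, Fin (k i))).comp continuous_snd))

end TotalSpace

section Equivariant

variable {X : Type u} [TopologicalSpace X] {τ : TopInvolution X} (E : InvBundle.{u, w} τ)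

/-- The involution of the total space squares to the identity. This is not a statement about one
fibre, as `τ (τ x)` is only propositionally equal to `x`. -/
theorem InvBundle.total_conj_conj {x : X} (v : E.fiber x) :
    (⟨τ (τ x), E.conj rfl (E.conj rfl v)⟩ : Total E.fiber) = ⟨x, v⟩ := by
  have key : ∀ (z : X) (hz : z = x) (h : z = τ (τ x)),
      (⟨z, E.conj h (E.conj rfl v)⟩ : Total E.fiber) = ⟨x, v⟩ := by
    rintro z rfl h
    rw [E.conj_conj]
  exact key _ (τ.involutive x) rfl

theorem InvBundle.total_conj {x y : X} (h : y = τ x) (v : E.fiber x) :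
    (⟨y, E.conj h v⟩ : Total E.fiber) = ⟨τ x, E.conj rfl v⟩ := by
  subst h
  rfl

theorem InvBundle.conj_congr {x x' y : X} (s : ∀ x, E.fiber x) (hx : x' = x) (h : y = τ x')
    (h' : y = τ x) : E.conj h (s x') = E.conj h' (s x) := by
  subst hx
  rfl

/-- A retraction `(J, K)` from a trivial bundle onto `E` which need not respect the involutions
yields one which does: for the inclusion, take the real and imaginary parts of `J` with respect
to the real structure `J ↦ conj ∘ J ∘ σ`, namely `a = J + conj J σ` and `b = i (J - conj J σ)`.
Since `a - i b = 2 J` and `conj a - i conj b = 2 J σ`, the projection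
`(a, b) ↦ (K (a - i b) + σ K (conj a - i conj b)) / 4` is a left inverse, and it is equivariant
because `σ` exchanges its two summands. -/
def InvBundle.equivariantRetraction {ι : Type*} (J : ∀ x, E.fiber x →ₗ[ℂ] (ι → ℂ))
    (K : ∀ x, (ι → ℂ) →ₗ[ℂ] E.fiber x) (hKJ : ∀ x v, K x (J x v) = v)
    (hJ : Continuous fun e : Total E.fiber => J e.base e.vec)
    (hK : Continuous fun z : X × (ι → ℂ) => (⟨z.1, K z.1 z.2⟩ : Total E.fiber)) :
    Retraction E (ι ⊕ ι) where
  incl x :=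
    { toFun := fun v => Sum.elim (J x v + star (J (τ x) (E.conj rfl v)))
        (Complex.I • (J x v - star (J (τ x) (E.conj rfl v))))
      map_add' := fun v v' => by
        ext (i | i) <;> simp <;> ring
      map_smul' := fun c v => by
        ext (i | i) <;> simp <;> ring }
  proj x :=
    { toFun := fun u =>
        K x ((1 / 4 : ℂ) • (u ∘ Sum.inl - Complex.I • (u ∘ Sum.inr))) +
        E.conj (τ.involutive x).symm (K (τ x)
          ((1 / 4 : ℂ) • (star (u ∘ Sum.inl) - Complex.I • star (u ∘ Sum.inr))))
      map_add' := fun u u' => by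
        have h1 : (1 / 4 : ℂ) • ((u + u') ∘ Sum.inl - Complex.I • ((u + u') ∘ Sum.inr)) =
            (1 / 4 : ℂ) • (u ∘ Sum.inl - Complex.I • (u ∘ Sum.inr)) +
              (1 / 4 : ℂ) • (u' ∘ Sum.inl - Complex.I • (u' ∘ Sum.inr)) := by
          ext i
          simp
          ring
        have h2 : (1 / 4 : ℂ) • (star ((u + u') ∘ Sum.inl) -
              Complex.I • star ((u + u') ∘ Sum.inr)) =
            (1 / 4 : ℂ) • (star (u ∘ Sum.inl) - Complex.I • star (u ∘ Sum.inr)) +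
              (1 / 4 : ℂ) • (star (u' ∘ Sum.inl) - Complex.I • star (u' ∘ Sum.inr)) := by
          ext i
          simp
          ring
        rw [h1, h2, map_add, map_add, map_add]
        abel
      map_smul' := fun c u => by
        have h1 : (1 / 4 : ℂ) • ((c • u) ∘ Sum.inl - Complex.I • ((c • u) ∘ Sum.inr)) =
            c • (1 / 4 : ℂ) • (u ∘ Sum.inl - Complex.I • (u ∘ Sum.inr)) := by
          ext i
          simp
          ring
        have h2 : (1 / 4 : ℂ) • (star ((c • u) ∘ Sum.inl) - Complex.I • star ((c • u) ∘ Sum.inr)) =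
            starRingEnd ℂ c •
              (1 / 4 : ℂ) • (star (u ∘ Sum.inl) - Complex.I • star (u ∘ Sum.inr)) := by
          ext i
          simp
          ring
        rw [h1, h2, LinearMap.map_smul (K x) c, LinearMap.map_smul (K (τ x)) (starRingEnd ℂ c),
          (E.conj _).map_smulₛₗ (starRingEnd ℂ c), Complex.conj_conj, ← smul_add]
        rfl }
  proj_incl x v := by
    have h1 : (1 / 4 : ℂ) • ((J x v + star (J (τ x) (E.conj rfl v))) -
        Complex.I • (Complex.I • (J x v - star (J (τ x) (E.conj rfl v))))) =
        (1 / 2 : ℂ) • J x v := by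
      ext i
      simp only [Pi.smul_apply, Pi.sub_apply, Pi.add_apply, smul_eq_mul]
      linear_combination (-(1 / 4) * (J x v i - star (J (τ x) (E.conj rfl v)) i)) * Complex.I_sq
    have h2 : (1 / 4 : ℂ) • (star (J x v + star (J (τ x) (E.conj rfl v))) -
        Complex.I • star (Complex.I • (J x v - star (J (τ x) (E.conj rfl v))))) =
        (1 / 2 : ℂ) • J (τ x) (E.conj rfl v) := by
      ext i
      simp only [Pi.smul_apply, Pi.sub_apply, Pi.add_apply, Pi.star_apply, smul_eq_mul, star_add,
        star_sub, star_mul', star_star, RCLike.star_def, Complex.conj_I,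
        Complex.conj_conj]
      linear_combination ((1 / 4) * (starRingEnd ℂ (J x v i) - (J (τ x) (E.conj rfl v)) i)) * Complex.I_sq
    change K x ((1 / 4 : ℂ) • ((J x v + star (J (τ x) (E.conj rfl v))) -
        Complex.I • (Complex.I • (J x v - star (J (τ x) (E.conj rfl v)))))) +
      E.conj (τ.involutive x).symm (K (τ x) ((1 / 4 : ℂ) •
        (star (J x v + star (J (τ x) (E.conj rfl v))) -
          Complex.I • star (Complex.I • (J x v - star (J (τ x) (E.conj rfl v))))))) = v
    rw [h1, h2, map_smul, map_smul, hKJ, hKJ, LinearMap.map_smulₛₗ, E.conj_conj, ← add_smul]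
    have : (1 / 2 : ℂ) + starRingEnd ℂ (1 / 2) = 1 := by
      norm_num [Complex.ext_iff]
    rw [this, one_smul]
  continuous_incl := by
    have hJ' := hJ.comp E.continuous_conj
    refine continuous_pi fun i => ?_
    obtain i | i := i
    · exact (continuous_apply i).comp (hJ.add hJ'.star)
    · exact (continuous_apply i).comp ((hJ.sub hJ'.star).const_smul Complex.I)
  continuous_proj := by
    have hl : Continuous fun z : X × (ι ⊕ ι → ℂ) => z.2 ∘ Sum.inl :=
      continuous_pi fun i => (continuous_apply (Sum.inl i)).comp continuous_snd
    have hr : Continuous fun z : X × (ι ⊕ ι → ℂ) => z.2 ∘ Sum.inr :=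
      continuous_pi fun i => (continuous_apply (Sum.inr i)).comp continuous_snd
    refine E.continuous_add ?_ ?_
    · exact hK.comp (continuous_fst.prodMk
        ((hl.sub (hr.const_smul Complex.I)).const_smul (1 / 4 : ℂ)))
    · have := E.continuous_conj.comp (hK.comp ((τ.continuous_toFun.comp continuous_fst).prodMk
        ((hl.star.sub (hr.star.const_smul Complex.I)).const_smul (1 / 4 : ℂ))))
      convert this using 2 with z
      exact E.total_conj _ _
  incl_conj x v := by
    have h : J (τ (τ x)) (E.conj rfl (E.conj rfl v)) = J x v :=
      congrArg (fun e : Total E.fiber => J e.base e.vec) (E.total_conj_conj v)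
    ext (i | i)
    · simp [h, add_comm]
    · simp [h]
      ring
  proj_star x u := by
    have h : ∀ c, E.conj (τ.involutive (τ x)).symm (K (τ (τ x)) c) = E.conj rfl (K x c) :=
      fun c => E.conj_congr (fun x => K x c) (τ.involutive x) _ _
    have hl : star u ∘ Sum.inl = star (u ∘ (Sum.inl : ι → ι ⊕ ι)) := rfl
    have hr : star u ∘ Sum.inr = star (u ∘ (Sum.inr : ι → ι ⊕ ι)) := rfl
    simp only [LinearMap.coe_mk, AddHom.coe_mk, hl, hr, star_star, map_add, E.conj_conj, h]
    rw [add_comm]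

end Equivariant

theorem rangeHom_surjective {X : Type u} [TopologicalSpace X] [CompactSpace X] [T2Space X]
    (τ : TopInvolution X) : Function.Surjective (rangeHom.{u, w} τ) := by
  rintro ⟨E⟩
  obtain ⟨ι, _, J, K, hKJ, hJ, hK⟩ := E.exists_linear_retraction
  obtain ⟨p, ⟨i⟩⟩ := (E.equivariantRetraction J K hKJ hJ hK).exists_iso_rangeBundle
  exact ⟨ProjClasses.mk p, (Vect.mk_eq.2 ⟨i⟩).symm⟩

/-! ### The isomorphism for compact spaces -/

theorem groth_lift_of {M : Type*} [AddCommMonoid M] {G : Type*} [AddCommGroup G] (f : M →+ G)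
    (m : M) : Algebra.GrothendieckAddGroup.lift f (Algebra.GrothendieckAddGroup.of m) = f m :=
  DFunLike.congr_fun (Algebra.GrothendieckAddGroup.lift.symm_apply_apply f) m

/-- The isomorphism of Grothendieck groups induced by an isomorphism of commutative monoids. -/
def grothCongr {M N : Type*} [AddCommMonoid M] [AddCommMonoid N] (e : M ≃+ N) :
    Algebra.GrothendieckAddGroup M ≃+ Algebra.GrothendieckAddGroup N :=
  AddMonoidHom.toAddEquiv
    (Algebra.GrothendieckAddGroup.lift (Algebra.GrothendieckAddGroup.of.comp e.toAddMonoidHom))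
    (Algebra.GrothendieckAddGroup.lift
      (Algebra.GrothendieckAddGroup.of.comp e.symm.toAddMonoidHom))
    (grothHom_ext fun m => by
      rw [AddMonoidHom.comp_apply, groth_lift_of, AddMonoidHom.comp_apply, groth_lift_of]
      exact congrArg Algebra.GrothendieckAddGroup.of (e.symm_apply_apply m))
    (grothHom_ext fun m => by
      rw [AddMonoidHom.comp_apply, groth_lift_of, AddMonoidHom.comp_apply, groth_lift_of]
      exact congrArg Algebra.GrothendieckAddGroup.of (e.apply_symm_apply m))

theorem grothCongr_of {M N : Type*} [AddCommMonoid M] [AddCommMonoid N] (e : M ≃+ N) (m : M) :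
    grothCongr e (Algebra.GrothendieckAddGroup.of m) = Algebra.GrothendieckAddGroup.of (e m) :=
  groth_lift_of (Algebra.GrothendieckAddGroup.of.comp e.toAddMonoidHom) m

section Theta

variable {X : Type u} [TopologicalSpace X] [CompactSpace X] [T2Space X]

/-- The isomorphism `KO₀(A(X, τ)) ≅ KR⁰(X, τ)`, `[p] ↦ [E_p]`, for compact `X`. -/
def theta (τ : TopInvolution X) : KO0 (invFunctions τ) ≃+ KR0.{u, w} τ :=
  grothCongr (AddEquiv.ofBijective (rangeHom τ) ⟨rangeHom_injective τ, rangeHom_surjective τ⟩)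

theorem theta_of (τ : TopInvolution X) (p : MatProj (invFunctions τ)) :
    theta.{u, w} τ (KO0.of p) = KR0.of (rangeBundle p) :=
  grothCongr_of _ _

theorem theta_natural {X₁ : Type u₁} {X₂ : Type u₂} [TopologicalSpace X₁] [CompactSpace X₁]
    [T2Space X₁] [TopologicalSpace X₂] [CompactSpace X₂] [T2Space X₂] {τ₁ : TopInvolution X₁}
    {τ₂ : TopInvolution X₂} (f : EquivariantMap τ₁ τ₂) (z : KO0 (invFunctions τ₂)) :
    theta.{u₁, w} τ₁ (KO0.map (invFunctionsMap f) z) = KR0.map f (theta.{u₂, w} τ₂ z) := by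
  have h : (theta.{u₁, w} τ₁).toAddMonoidHom.comp (KO0.map (invFunctionsMap f)) =
      (KR0.map f).comp (theta.{u₂, w} τ₂).toAddMonoidHom := by
    refine grothHom_ext fun m => ?_
    obtain ⟨p⟩ := m
    change theta τ₁ (KO0.map (invFunctionsMap f) (KO0.of p)) = KR0.map f (theta τ₂ (KO0.of p))
    rw [KO0.map_of, theta_of, theta_of, KR0.map_of]
    exact congrArg Algebra.GrothendieckAddGroup.of (Vect.mk_eq.2 (rangeBundle_map f p)).symm
  exact DFunLike.congr_fun h z

end Theta

/-! ### The isomorphism for locally compact spaces -/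

section LocallyCompact

section Functoriality

variable {A : Type v} {B : Type w} [Ring A] [StarRing A] [Ring B] [StarRing B] [Algebra ℝ A]
  [Algebra ℝ B]

theorem KO0.map_map {C : Type*} [Ring C] [StarRing C] [Algebra ℝ C] (g : B →⋆ₐ[ℝ] C)
    (f : A →⋆ₐ[ℝ] B) (z : KO0 A) : KO0.map g (KO0.map f z) = KO0.map (g.comp f) z := by
  rw [KO0.map_comp]
  rfl

theorem KO0.map_map_eq {C : Type*} {D : Type*} [Ring C] [StarRing C] [Algebra ℝ C] [Ring D]
    [StarRing D] [Algebra ℝ D] {f : A →⋆ₐ[ℝ] B} {g : B →⋆ₐ[ℝ] D} {f' : A →⋆ₐ[ℝ] C}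
    {g' : C →⋆ₐ[ℝ] D} (h : ∀ a, g (f a) = g' (f' a)) (z : KO0 A) :
    KO0.map g (KO0.map f z) = KO0.map g' (KO0.map f' z) := by
  rw [KO0.map_map, KO0.map_map, show g.comp f = g'.comp f' from StarAlgHom.ext h]

theorem KO0.map_id (z : KO0 A) : KO0.map (StarAlgHom.id ℝ A) z = z := by
  have h : KO0.map (StarAlgHom.id ℝ A) = AddMonoidHom.id _ := by
    refine grothHom_ext fun m => ?_
    obtain ⟨p⟩ := m
    exact KO0.map_of _ p
  rw [h]
  rfl

theorem KO0.map_bijective (f : A →⋆ₐ[ℝ] B) (hf : Function.Bijective f) :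
    Function.Bijective (KO0.map f) := by
  let e : A ≃⋆ₐ[ℝ] B := StarAlgEquiv.ofBijective f hf
  let g : B →⋆ₐ[ℝ] A := e.symm
  have h1 : g.comp f = StarAlgHom.id ℝ A := StarAlgHom.ext fun a => e.symm_apply_apply a
  have h2 : f.comp g = StarAlgHom.id ℝ B := StarAlgHom.ext fun b => e.apply_symm_apply b
  refine Function.bijective_iff_has_inverse.2 ⟨KO0.map g, fun z => ?_, fun z => ?_⟩
  · rw [KO0.map_map, h1, KO0.map_id]
  · rw [KO0.map_map, h2, KO0.map_id]

end Functoriality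

/-- Evaluation `A(pt) → ℝ`; the functions in `A(pt)` are real. -/
def evalPoint : invFunctions pointInvolution →⋆ₐ[ℝ] ℝ where
  toFun f := (f.1 ()).re
  map_one' := rfl
  map_mul' f g := by
    have hf : (f.1 ()).im = 0 := Complex.conj_eq_iff_im.1 (f.2 ()).symm
    change (f.1 () * g.1 ()).re = _
    rw [Complex.mul_re, hf, zero_mul, sub_zero]
  map_zero' := rfl
  map_add' _ _ := rfl
  commutes' _ := rfl
  map_star' _ := rfl

theorem unitizationToOnePoint_bijective {X : Type u} [TopologicalSpace X] [T2Space X]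
    (τ : TopInvolution X) :
    Function.Bijective (unitizationToOnePoint τ) := by
  constructor
  · intro a b h
    have h1 : a.fst = b.fst := by
      have := congrArg (fun g : invFunctions τ.onePoint => g.1 OnePoint.infty) h
      simp only [unitizationToOnePoint_infty] at this
      exact Complex.ofReal_injective this
    refine Unitization.ext h1 (Subtype.ext (ZeroAtInftyContinuousMap.ext fun x => ?_))
    have := congrArg (fun g : invFunctions τ.onePoint => g.1 (x : OnePoint X)) h
    simp only [unitizationToOnePoint_coe, h1] at this
    exact add_right_cancel this
  · intro g
    -- The value of `g` at `∞` is real, and `g - g(∞)` vanishes at infinity.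
    have him : (g.1 OnePoint.infty).im = 0 :=
      Complex.conj_eq_iff_im.1 (g.2 OnePoint.infty).symm
    have hre : ((g.1 OnePoint.infty).re : ℂ) = g.1 OnePoint.infty :=
      Complex.ext rfl him.symm
    let f : invFunctionsZero τ := ⟨⟨⟨fun x : X => g.1 x - g.1 OnePoint.infty,
      (g.1.continuous.comp OnePoint.continuous_coe).sub continuous_const⟩, by
        have h := ((g.1.continuous.tendsto OnePoint.infty).comp
          OnePoint.tendsto_coe_infty).sub_const (g.1 OnePoint.infty)
        rw [sub_self, Filter.coclosedCompact_eq_cocompact] at h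
        exact h⟩, fun x => by
        change g.1 (τ x : OnePoint X) - g.1 OnePoint.infty =
          starRingEnd ℂ (g.1 x - g.1 OnePoint.infty)
        rw [map_sub, ← g.2 OnePoint.infty, ← g.2 x]
        rfl⟩
    refine ⟨Unitization.inl (g.1 OnePoint.infty).re + (f : Unitization ℝ _),
      Subtype.ext (ContinuousMap.ext fun x => ?_)⟩
    induction x using OnePoint.rec with
    | infty =>
      rw [unitizationToOnePoint_infty]
      simpa using hre
    | coe x =>
      rw [unitizationToOnePoint_coe]
      have : (f.1 x : ℂ) = g.1 x - g.1 OnePoint.infty := rfl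
      simp [this, hre]

theorem unitization_starMap_eq {A : Type v} {B : Type w} [NonUnitalRing A] [StarRing A]
    [Module ℝ A] [IsScalarTower ℝ A A] [SMulCommClass ℝ A A] [StarModule ℝ A] [NonUnitalRing B]
    [StarRing B] [Module ℝ B] [IsScalarTower ℝ B B] [SMulCommClass ℝ B B] [StarModule ℝ B]
    (φ : A →⋆ₙₐ[ℝ] B) (a : Unitization ℝ A) :
    (Unitization.starMap φ a).fst = a.fst ∧ (Unitization.starMap φ a).snd = φ a.snd := by
  induction a with
  | inl_add_inr r a => simp [Unitization.algebraMap_eq_inl]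

theorem unitizationToOnePoint_starMap {X₁ : Type u₁} {X₂ : Type u₂} [TopologicalSpace X₁]
    [T2Space X₁] [TopologicalSpace X₂] [T2Space X₂] {τ₁ : TopInvolution X₁}
    {τ₂ : TopInvolution X₂} (f : ProperEquivariantMap τ₁ τ₂)
    (a : Unitization ℝ (invFunctionsZero τ₂)) :
    unitizationToOnePoint τ₁ (Unitization.starMap (invFunctionsZeroMap f) a) =
      invFunctionsMap f.onePoint (unitizationToOnePoint τ₂ a) := by
  obtain ⟨h1, h2⟩ := unitization_starMap_eq (B := invFunctionsZero τ₁) (invFunctionsZeroMap f) a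
  refine Subtype.ext (ContinuousMap.ext fun x => ?_)
  induction x using OnePoint.rec with
  | infty =>
    refine (unitizationToOnePoint_infty τ₁ _).trans
      (Eq.trans ?_ (unitizationToOnePoint_infty τ₂ a).symm)
    exact congrArg Complex.ofReal h1
  | coe x =>
    refine (unitizationToOnePoint_coe τ₁ _ x).trans
      (Eq.trans ?_ (unitizationToOnePoint_coe τ₂ a (f.toFun x)).symm)
    exact congrArg₂ (· + ·) (congrArg (fun g : invFunctionsZero τ₁ => g.1 x) h2)
      (congrArg Complex.ofReal h1)

section Restriction

variable {X : Type u} [TopologicalSpace X] [LocallyCompactSpace X] [T2Space X]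

/-- The composite `KO₀(A₀(X, τ)⁺) ≅ KO₀(A(X⁺, τ⁺)) ≅ KR⁰(X⁺, τ⁺)`. -/
def thetaPlus (τ : TopInvolution X) :
    KO0 (Unitization ℝ (invFunctionsZero τ)) →+ KR0.{u, w} τ.onePoint :=
  (theta τ.onePoint).toAddMonoidHom.comp (KO0.map (unitizationToOnePoint τ))

theorem thetaPlus_apply (τ : TopInvolution X) (z : KO0 (Unitization ℝ (invFunctionsZero τ))) :
    thetaPlus.{u, w} τ z = theta τ.onePoint (KO0.map (unitizationToOnePoint τ) z) := rfl

theorem thetaPlus_bijective (τ : TopInvolution X) : Function.Bijective (thetaPlus.{u, w} τ) :=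
  (theta τ.onePoint).bijective.comp
    (KO0.map_bijective _ (unitizationToOnePoint_bijective τ))

/-- `KO₀(A₀(X, τ))` and `KR⁰(X, τ)` correspond: both are the kernel of restriction to `∞`. -/
theorem thetaPlus_mem_iff (τ : TopInvolution X)
    (z : KO0 (Unitization ℝ (invFunctionsZero τ))) :
    thetaPlus.{u, w} τ z ∈ KR0lc τ ↔ z ∈ KO0nonunital (invFunctionsZero τ) := by
  -- Restriction to `∞` is `A₀(X, τ)⁺ → ℝ` followed by `ℝ → A(pt)`; conversely, `A₀(X, τ)⁺ → ℝ` is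
  -- restriction to `∞` followed by evaluation. So both have the same kernel on `KO₀`.
  let j : Unitization ℝ (invFunctionsZero τ) →⋆ₐ[ℝ] invFunctions pointInvolution :=
    (invFunctionsMap (inftyMap τ)).comp (unitizationToOnePoint τ)
  have h : KR0.map (inftyMap τ) (thetaPlus.{u, w} τ z) = theta pointInvolution (KO0.map j z) :=
    (theta_natural (inftyMap τ) _).symm.trans
      (congrArg (theta pointInvolution) (KO0.map_map _ _ z))
  have h1 : evalPoint.comp j = unitizationProj (invFunctionsZero τ) :=
    StarAlgHom.ext fun a => by
      change ((unitizationToOnePoint τ a).1 OnePoint.infty).re = a.fst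
      rw [unitizationToOnePoint_infty, Complex.ofReal_re]
  let c : ℝ →⋆ₐ[ℝ] invFunctions pointInvolution := StarAlgHom.ofId ℝ _
  have h2 : c.comp (unitizationProj (invFunctionsZero τ)) = j :=
    StarAlgHom.ext fun a => Subtype.ext (ContinuousMap.ext fun _ => by
      change (a.fst : ℂ) = (unitizationToOnePoint τ a).1 OnePoint.infty
      rw [unitizationToOnePoint_infty])
  change KR0.map (inftyMap τ) (thetaPlus.{u, w} τ z) = 0 ↔
    KO0.map (unitizationProj (invFunctionsZero τ)) z = 0
  rw [h, EmbeddingLike.map_eq_zero_iff]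
  constructor
  · intro hz
    rw [← h1, ← KO0.map_map, hz, map_zero]
  · intro hz
    rw [← h2, ← KO0.map_map, hz, map_zero]

/-- The isomorphism `KO₀(A₀(X, τ)) ≅ KR⁰(X, τ)` for locally compact `X`. -/
def thetaZero (τ : TopInvolution X) :
    KO0nonunital (invFunctionsZero τ) ≃+ KR0lc.{u, w} τ :=
  AddEquiv.ofBijective
    (((thetaPlus τ).comp (KO0nonunital (invFunctionsZero τ)).subtype).codRestrict (KR0lc τ)
      fun z => (thetaPlus_mem_iff τ z).2 z.2)
    ⟨fun _ _ h => Subtype.ext ((thetaPlus_bijective τ).1 (congrArg Subtype.val h)), fun y => by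
      obtain ⟨z, hz⟩ := (thetaPlus_bijective τ).2 y
      exact ⟨⟨z, (thetaPlus_mem_iff τ z).1 (hz ▸ y.2)⟩, Subtype.ext hz⟩⟩

theorem thetaZero_coe (τ : TopInvolution X) (z : KO0nonunital (invFunctionsZero τ)) :
    (thetaZero.{u, w} τ z : KR0.{u, w} τ.onePoint) =
      theta τ.onePoint (KO0.map (unitizationToOnePoint τ)
        (z : KO0 (Unitization ℝ (invFunctionsZero τ)))) := rfl

end Restriction

section Naturality

variable {X₁ : Type u₁} {X₂ : Type u₂} [TopologicalSpace X₁] [LocallyCompactSpace X₁] [T2Space X₁]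
  [TopologicalSpace X₂] [LocallyCompactSpace X₂] [T2Space X₂] {τ₁ : TopInvolution X₁}
  {τ₂ : TopInvolution X₂}

theorem thetaPlus_natural (f : ProperEquivariantMap τ₁ τ₂)
    (z : KO0 (Unitization ℝ (invFunctionsZero τ₂))) :
    thetaPlus.{u₁, w} τ₁ (KO0.map (Unitization.starMap (invFunctionsZeroMap f)) z) =
      KR0.map f.onePoint (thetaPlus.{u₂, w} τ₂ z) := by
  rw [thetaPlus_apply, thetaPlus_apply]
  refine (congrArg (theta τ₁.onePoint) ?_).trans (theta_natural f.onePoint _)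
  exact KO0.map_map_eq (fun a => unitizationToOnePoint_starMap f a) z

theorem thetaZero_natural (f : ProperEquivariantMap τ₁ τ₂)
    (z : KO0nonunital (invFunctionsZero τ₂)) :
    thetaZero.{u₁, w} τ₁ (KO0nonunital.map (invFunctionsZeroMap f) z) =
      KR0lc.map f (thetaZero.{u₂, w} τ₂ z) :=
  Subtype.ext (thetaPlus_natural f (z : KO0 (Unitization ℝ (invFunctionsZero τ₂))))

end Naturality

end LocallyCompact

end KRTheory

end

theorem mainTheorem1 :
    ∃ Θ : ∀ (X : Type u) [TopologicalSpace X] [CompactSpace X] [T2Space X]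
        (τ : KRTheory.TopInvolution X),
        KRTheory.KO0 (KRTheory.invFunctions τ) ≃+ KRTheory.KR0.{u, w} τ,
      -- `Θ` is induced by `p ↦ E_p`
      (∀ (X : Type u) [TopologicalSpace X] [CompactSpace X] [T2Space X]
        (τ : KRTheory.TopInvolution X) (p : KRTheory.MatProj (KRTheory.invFunctions τ)),
        Θ X τ (KRTheory.KO0.of p) = KRTheory.KR0.of (KRTheory.rangeBundle p)) ∧
      -- `Θ` is natural for maps of compact spaces with involution
      (∀ (X₁ X₂ : Type u) [TopologicalSpace X₁] [CompactSpace X₁] [T2Space X₁]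
        [TopologicalSpace X₂] [CompactSpace X₂] [T2Space X₂]
        (τ₁ : KRTheory.TopInvolution X₁) (τ₂ : KRTheory.TopInvolution X₂)
        (f : KRTheory.EquivariantMap τ₁ τ₂) (z : KRTheory.KO0 (KRTheory.invFunctions τ₂)),
        Θ X₁ τ₁ (KRTheory.KO0.map (KRTheory.invFunctionsMap f) z) =
          KRTheory.KR0.map f (Θ X₂ τ₂ z)) ∧
      -- the locally compact case
      ∃ Θ' : ∀ (X : Type u) [TopologicalSpace X] [LocallyCompactSpace X] [T2Space X]
          (τ : KRTheory.TopInvolution X),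
          KRTheory.KO0nonunital (KRTheory.invFunctionsZero τ) ≃+ KRTheory.KR0lc.{u, w} τ,
        -- `Θ'` is the restriction of `Θ` for the one-point compactification
        (∀ (X : Type u) [TopologicalSpace X] [LocallyCompactSpace X] [T2Space X]
          (τ : KRTheory.TopInvolution X)
          (z : KRTheory.KO0nonunital (KRTheory.invFunctionsZero τ)),
          (Θ' X τ z : KRTheory.KR0.{u, w} τ.onePoint) =
            Θ (OnePoint X) τ.onePoint
              (KRTheory.KO0.map (KRTheory.unitizationToOnePoint τ)
                (z : KRTheory.KO0 (Unitization ℝ (KRTheory.invFunctionsZero τ))))) ∧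
        -- `Θ'` is natural for proper maps of locally compact spaces with involution
        (∀ (X₁ X₂ : Type u) [TopologicalSpace X₁] [LocallyCompactSpace X₁] [T2Space X₁]
          [TopologicalSpace X₂] [LocallyCompactSpace X₂] [T2Space X₂]
          (τ₁ : KRTheory.TopInvolution X₁) (τ₂ : KRTheory.TopInvolution X₂)
          (f : KRTheory.ProperEquivariantMap τ₁ τ₂)
          (z : KRTheory.KO0nonunital (KRTheory.invFunctionsZero τ₂)),
          Θ' X₁ τ₁ (KRTheory.KO0nonunital.map (KRTheory.invFunctionsZeroMap f) z) =
            KRTheory.KR0lc.map f (Θ' X₂ τ₂ z)) :=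
  ⟨fun _ _ _ _ τ => KRTheory.theta τ, fun _ _ _ _ τ p => KRTheory.theta_of τ p,
    fun _ _ _ _ _ _ _ _ _ _ f z => KRTheory.theta_natural f z,
    fun _ _ _ _ τ => KRTheory.thetaZero τ, fun _ _ _ _ τ z => KRTheory.thetaZero_coe τ z,
    fun _ _ _ _ _ _ _ _ _ _ f z => KRTheory.thetaZero_natural f z⟩
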